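/- **Theorem (Neumann finite trace inequality).** Let $q:[0,\pi]\to\mathbb{R}$ be the sum of its absolutely convergent cosine series, i.e. with $$q_k=\frac{2}{\pi}\int_0^\pi q(x)\cos(kx)\,dx\quad(k\ge 0)$$ we have $\sum_{k\ge 0}|q_k|<\infty$ and $q(x)=\frac{q_0}{2}+\sum_{k=1}^\infty q_k\cos(kx)$ for all $x\in[0,\pi]$. Let $\mu_0\le\mu_1\le\mu_2\le\dots$ be the eigenvalues, in increasing order and repeated according to multiplicity, of the Neumann problem $$-u''+qu=\mu u\ \text{ on }(0,\pi),\qquad u'(0)=u'(\pi)=0,$$ understood weakly: a nonzero $u\in H^1(0,\pi)$ is an eigenfunction with eigenvalue $\mu$ if $\int_0^\pi u'\varphi'\,dx+\int_0^\pi q\,u\,\varphi\,dx=\mu\int_0^\pi u\,\varphi\,dx$ for all $\varphi\in H^1(0,\pi)$. That is, $\mu_k$ is the least real $t$ for which there are $k+1$ linearly independent eigenfunctions with eigenvalues at most $t$; such a least $t$ exists for every $k\ge 0$. Then: 1. For every $n\ge 0$, $$\sum_{k=0}^n\left(\mu_k-k^2-\frac{q_0}{2}\right)\le\frac12\sum_{k=1}^n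 q_{2k}.$$ 2. If equality holds for some $n\ge 0$, then $q$ is constant on $[0,\pi]$. 3. As $n\to\infty$, the right-hand side $\frac12\sum_{k=1}^n q_{2k}$ converges to $$-\frac12\cdot\frac1\pi\int_0^\pi q(x)\,dx+\frac{q(0)+q(\pi)}{4}.$$ -/

import Mathlib

open Real MeasureTheory Filter Topology
open scoped ContDiff

namespace NeumannTrace

/-- The real Hilbert space `L²(0, π)` (classes of functions modulo a.e. equality). -/
abbrev L2 : Type := Lp ℝ 2 (volume.restrict (Set.Ioo (0 : ℝ) π))

/-- `v ∈ L²(0, π)` is the weak derivative of `u ∈ L²(0, π)`. Thus `u` lies in the Sobolev space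
`H¹(0, π)` exactly when `∃ v, HasWeakDeriv u v`. -/
def HasWeakDeriv (u v : L2) : Prop :=
  ∀ φ : ℝ → ℝ, ContDiff ℝ ∞ φ → HasCompactSupport φ → tsupport φ ⊆ Set.Ioo 0 π →
    ∫ x in Set.Ioo 0 π, u x * deriv φ x = -∫ x in Set.Ioo 0 π, v x * φ x

/-- `u` is an eigenfunction, with eigenvalue `ν`, of the Neumann problem
`-u'' + q u = ν u` on `(0, π)`, `u'(0) = u'(π) = 0`, in the usual weak sense: `u ∈ H¹(0, π)`,
`u ≠ 0`, and `∫ u' φ' + ∫ q u φ = ν ∫ u φ` for every test function `φ ∈ H¹(0, π)`. -/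
def IsNeumannEigenfunction (q : ℝ → ℝ) (ν : ℝ) (u : L2) : Prop :=
  u ≠ 0 ∧ ∃ u' : L2, HasWeakDeriv u u' ∧ ∀ φ φ' : L2, HasWeakDeriv φ φ' →
    (∫ x in Set.Ioo 0 π, u' x * φ' x) + (∫ x in Set.Ioo 0 π, q x * (u x * φ x))
      = ν * ∫ x in Set.Ioo 0 π, u x * φ x

/-- The set of levels `t` up to which there are, counted with multiplicity, at least `k + 1`
Neumann eigenvalues: there are `k + 1` linearly independent eigenfunctions whose eigenvalues
are at most `t`. -/
def neumannLevels (q : ℝ → ℝ) (k : ℕ) : Set ℝ :=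
  {t | ∃ u : Fin (k + 1) → L2, LinearIndependent ℝ u ∧
    ∀ i, ∃ ν ≤ t, IsNeumannEigenfunction q ν (u i)}

/-- The Neumann eigenvalue `μ_k(q)`, `k = 0, 1, 2, …`: the eigenvalues are listed in increasing
order and repeated according to multiplicity, so that `μ_k(q)` is the smallest level up to which
there are at least `k + 1` eigenvalues. -/
noncomputable def neumannEigenvalue (q : ℝ → ℝ) (k : ℕ) : ℝ :=
  sInf (neumannLevels q k)

/-- The cosine coefficient `q_k = (2/π) ∫_0^π q(x) cos(kx) dx`. -/
noncomputable def cosCoeff (q : ℝ → ℝ) (k : ℕ) : ℝ :=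
  2 / π * ∫ x in (0 : ℝ)..π, q x * cos (k * x)

/-- `q` is on `[0, π]` the sum of its absolutely convergent cosine series
`q(x) = q_0 / 2 + ∑_{k ≥ 1} q_k cos(kx)`. -/
def HasAbsConvCosineSeries (q : ℝ → ℝ) : Prop :=
  Summable (fun k : ℕ => |cosCoeff q k|) ∧
    ∀ x ∈ Set.Icc 0 π,
      HasSum (fun k : ℕ => cosCoeff q (k + 1) * cos ((k + 1 : ℕ) * x)) (q x - cosCoeff q 0 / 2)

end NeumannTrace

/-! Multiplication by `q` is a bounded symmetric operator `Q` on `L²(0, π)`. In the orthonormal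
basis `e k` of normalised cosines, the Neumann operator `A` is the diagonal of the `k²` plus `Q`. By
the product formula for cosines, its diagonal entries are `k² + q_0/2 + q_{2k}/2` for `k ≥ 1` and
`q_0/2` for `k = 0`. Ky Fan's principle bounds the sum of the `n + 1` lowest eigenvalues by the
trace of `A` compressed to `e 0, …, e n`; this is the inequality.

In case of equality `A` maps `e 0, …, e n` into their own span, so `q_{m-i} + q_{m+i} = 0` for `i ≤
n < m`. Taking `i = 0` and then `i = n` kills every `q_j` with `j ≥ 1`.

To avoid unbounded operators, `A + c` with `c > ‖Q‖` is handled through its compact inverse `T`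
(`exists_resolvent`), and `kyFan` is stated for `T⁻¹`. The link with weak eigenfunctions is
`isNeumannEigenfunction_iff`, which rests on `HasWeakDeriv.inner_sinMap`. The limit comes from
adding the cosine series at `0` and `π`. -/

namespace NeumannTrace

open scoped RealInnerProductSpace

/-! ### Spectral theory of compact positive injective operators -/

section Abstract

variable {H : Type*} [NormedAddCommGroup H] [InnerProductSpace ℝ H]

/-- A compact, symmetric, positive and injective operator. -/
structure IsPosCompact (T : H →L[ℝ] H) : Prop where
  symm : ∀ x y, ⟪T x, y⟫ = ⟪x, T y⟫
  nonneg : ∀ x, 0 ≤ ⟪T x, x⟫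
  inj : ∀ x, T x = 0 → x = 0
  compact : IsCompactOperator T

namespace IsPosCompact

variable {T : H →L[ℝ] H}

/-- Cauchy–Schwarz for the form `⟪T ·, ·⟫`, from the discriminant of its value at `x + t • y`. -/
theorem inner_sq_le (hT : IsPosCompact T) (x y : H) :
    ⟪T x, y⟫ ^ 2 ≤ ⟪T x, x⟫ * ⟪T y, y⟫ := by
  have h : ∀ t : ℝ, 0 ≤ ⟪T y, y⟫ * (t * t) + (2 * ⟪T x, y⟫) * t + ⟪T x, x⟫ := by
    intro t
    have h1 := hT.nonneg (x + t • y)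
    have h2 : ⟪T y, x⟫ = ⟪T x, y⟫ := by rw [hT.symm, real_inner_comm]
    simp only [map_add, map_smul, inner_add_left, inner_add_right, real_inner_smul_left,
      real_inner_smul_right, h2] at h1
    linarith
  have := discrim_le_zero h
  unfold discrim at this
  linarith

theorem pos (hT : IsPosCompact T) {x : H} (hx : x ≠ 0) : 0 < ⟪T x, x⟫ := by
  refine lt_of_le_of_ne (hT.nonneg x) fun h => hx (hT.inj x ?_)
  have h1 := hT.inner_sq_le x (T x)
  rw [← h, zero_mul] at h1
  have h2 : ⟪T x, T x⟫ = 0 := by nlinarith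
  exact inner_self_eq_zero.1 h2

/-- On a nonzero closed invariant subspace the Rayleigh quotient attains its maximum, at an
eigenvector. -/
theorem exists_max_eigenvector (hT : IsPosCompact T) (V : Submodule ℝ H)
    (hVc : IsClosed (V : Set H)) (hV : ∀ x ∈ V, T x ∈ V) (hne : V ≠ ⊥) :
    ∃ u ∈ V, ‖u‖ = 1 ∧ ∃ τ : ℝ, 0 < τ ∧ T u = τ • u ∧ ∀ f ∈ V, ⟪T f, f⟫ ≤ τ * ‖f‖ ^ 2 := by
  set S : Set ℝ := {r | ∃ f ∈ V, ‖f‖ = 1 ∧ ⟪T f, f⟫ = r} with hS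
  have hbdd : BddAbove S := by
    refine ⟨‖T‖, ?_⟩
    rintro _ ⟨f, -, hf, rfl⟩
    calc ⟪T f, f⟫ ≤ ‖T f‖ * ‖f‖ := real_inner_le_norm _ _
      _ ≤ ‖T‖ := by simpa [hf] using T.le_opNorm f
  obtain ⟨x, hxV, hx0⟩ := (Submodule.ne_bot_iff _).1 hne
  have hnx : ‖x‖ ≠ 0 := norm_ne_zero_iff.2 hx0
  have hmem : ∀ f ∈ V, f ≠ 0 → ⟪T f, f⟫ / ‖f‖ ^ 2 ∈ S := by
    intro f hf h0
    have : ‖f‖ ≠ 0 := norm_ne_zero_iff.2 h0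
    refine ⟨‖f‖⁻¹ • f, V.smul_mem _ hf, by simp [norm_smul, this], ?_⟩
    simp only [map_smul, real_inner_smul_left, real_inner_smul_right]
    field_simp
  set τ := sSup S with hτ
  have hτpos : 0 < τ :=
    (div_pos (hT.pos hx0) (by positivity)).trans_le (le_csSup hbdd (hmem x hxV hx0))
  have hmax : ∀ f ∈ V, ⟪T f, f⟫ ≤ τ * ‖f‖ ^ 2 := by
    intro f hf
    by_cases h0 : f = 0
    · simp [h0]
    have : 0 < ‖f‖ := norm_pos_iff.2 h0
    exact (div_le_iff₀ (by positivity)).1 (le_csSup hbdd (hmem f hf h0))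
  obtain ⟨r, -, hr, hrS⟩ := exists_seq_tendsto_sSup ⟨_, hmem x hxV hx0⟩ hbdd
  choose f hfV hf1 hfr using hrS
  -- Cauchy–Schwarz for the form at `f n` and `T (f n)` gives `‖T f‖⁴ ≤ r · τ‖T f‖²`.
  have hTf : ∀ n, ‖T (f n)‖ ^ 2 ≤ τ * r n := by
    intro n
    have h1 := hT.inner_sq_le (f n) (T (f n))
    have h2 := hmax _ (hV _ (hfV n))
    rw [real_inner_self_eq_norm_sq, hfr] at h1
    have h3 : 0 ≤ r n := hfr n ▸ hT.nonneg _
    by_cases h0 : ‖T (f n)‖ = 0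
    · rw [h0]; simpa using mul_nonneg hτpos.le h3
    have h4 : 0 < ‖T (f n)‖ ^ 2 := by positivity
    have h5 := h1.trans (mul_le_mul_of_nonneg_left h2 h3)
    nlinarith
  -- A maximising sequence consists of approximate eigenvectors; since `τ > 0`, convergence of `T (f
  -- n)` along a subsequence then forces that of `f n`.
  have hdiff : Tendsto (fun n => T (f n) - τ • f n) atTop (𝓝 0) := by
    have h1 : ∀ n, ‖T (f n) - τ • f n‖ ^ 2 ≤ τ * (τ - r n) := by
      intro n
      rw [norm_sub_sq_real, real_inner_smul_right, hfr, norm_smul, hf1, mul_one,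
        Real.norm_eq_abs, sq_abs]
      linarith [hTf n]
    have h2 : Tendsto (fun n => τ * (τ - r n)) atTop (𝓝 0) := by
      have := (tendsto_const_nhds (x := τ)).mul ((tendsto_const_nhds (x := τ)).sub hr)
      simpa [← hτ] using this
    have h3 := squeeze_zero (fun n => by positivity) h1 h2
    rw [tendsto_zero_iff_norm_tendsto_zero]
    have h4 := h3.sqrt
    simpa using h4
  obtain ⟨K, hK, hKs⟩ := IsCompactOperator.image_closedBall_subset_compact
    (f := (T : H →ₗ[ℝ] H)) hT.compact 1
  obtain ⟨y, -, φ, hφ, hy⟩ := hK.tendsto_subseq (x := fun n => T (f n))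
    (fun n => hKs ⟨f n, by simp [hf1], rfl⟩)
  have hu : Tendsto (fun n => f (φ n)) atTop (𝓝 (τ⁻¹ • y)) := by
    have h1 := hy.sub (hdiff.comp hφ.tendsto_atTop)
    have h2 := h1.const_smul τ⁻¹
    simpa [Function.comp_def, smul_smul, inv_mul_cancel₀ hτpos.ne'] using h2
  refine ⟨τ⁻¹ • y, hVc.mem_of_tendsto hu (Eventually.of_forall fun n => hfV _), ?_, τ, hτpos, ?_,
    hmax⟩
  · have := hu.norm
    simp only [hf1] at this
    exact tendsto_nhds_unique this tendsto_const_nhds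
  · have h1 := (T.continuous.tendsto _).comp hu
    rw [tendsto_nhds_unique h1 hy, smul_smul, mul_inv_cancel₀ hτpos.ne', one_smul]

/-- A sequence of orthonormal eigenvectors of `T` obtained by successive maximisation of the
Rayleigh quotient. -/
structure IsEigenSeq (T : H →L[ℝ] H) (u : ℕ → H) (τ : ℕ → ℝ) : Prop where
  orthonormal : Orthonormal ℝ u
  pos : ∀ n, 0 < τ n
  apply : ∀ n, T (u n) = τ n • u n
  le : ∀ n f, (∀ i < n, ⟪u i, f⟫ = 0) → ⟪T f, f⟫ ≤ τ n * ‖f‖ ^ 2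

/-- The maximisation is repeated on the orthogonal complement of the eigenvectors already found,
which is invariant by symmetry and never zero in infinite dimension. -/
theorem exists_isEigenSeq [CompleteSpace H] (hT : IsPosCompact T)
    (hH : ¬ FiniteDimensional ℝ H) : ∃ u τ, IsEigenSeq T u τ := by
  classical
  -- The hypotheses on `U` stand after `∃ u`, so that `next` is a total function of `U` and can
  -- drive a plain recursion.
  have key : ∀ U : Submodule ℝ H, ∃ u : H, FiniteDimensional ℝ U → (∀ x ∈ U, T x ∈ U) →
      u ∈ Uᗮ ∧ ‖u‖ = 1 ∧ ∃ τ : ℝ, 0 < τ ∧ T u = τ • u ∧ ∀ f ∈ Uᗮ, ⟪T f, f⟫ ≤ τ * ‖f‖ ^ 2 := by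
    intro U
    by_cases h : FiniteDimensional ℝ U ∧ ∀ x ∈ U, T x ∈ U
    · obtain ⟨hfin, hinv⟩ := h
      obtain ⟨u, hu⟩ := hT.exists_max_eigenvector Uᗮ U.isClosed_orthogonal
        (fun x hx y hy => by
          rw [← hT.symm]; exact hx _ (hinv y hy))
        (fun hbot => hH (by
          rw [Submodule.orthogonal_eq_bot_iff] at hbot
          subst hbot
          exact Module.finite_def.2 ((Submodule.fg_iff_finiteDimensional _).2 hfin)))
      exact ⟨u, fun _ _ => hu⟩
    · exact ⟨0, fun h1 h2 => absurd ⟨h1, h2⟩ h⟩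
  choose next hnext using key
  obtain ⟨U, hU0, hUs⟩ : ∃ U : ℕ → Submodule ℝ H, U 0 = ⊥ ∧
      ∀ n, U (n + 1) = U n ⊔ Submodule.span ℝ {next (U n)} :=
    ⟨fun n => Nat.rec ⊥ (fun _ V => V ⊔ Submodule.span ℝ {next V}) n, rfl, fun _ => rfl⟩
  have hU : ∀ n : ℕ, FiniteDimensional ℝ ↥(U n) ∧ ∀ x ∈ U n, T x ∈ U n := by
    intro n
    induction n with
    | zero =>
      rw [hU0]
      refine ⟨by infer_instance, fun x hx => ?_⟩
      rw [(Submodule.mem_bot ℝ).1 hx, map_zero]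
      exact Submodule.zero_mem _
    | succ n ih =>
      obtain ⟨h1, h2⟩ := ih
      rw [hUs]
      refine ⟨by infer_instance, fun x hx => ?_⟩
      obtain ⟨-, -, τ, -, hτ, -⟩ := hnext (U n) h1 h2
      obtain ⟨y, hy, z, hz, rfl⟩ := Submodule.mem_sup.1 hx
      obtain ⟨a, rfl⟩ := Submodule.mem_span_singleton.1 hz
      rw [map_add, map_smul, hτ, smul_comm]
      exact Submodule.add_mem_sup (h2 y hy)
        (Submodule.smul_mem _ _ (Submodule.smul_mem _ _ (Submodule.mem_span_singleton_self _)))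
  have hmem : ∀ i n, i < n → next (U i) ∈ U n := by
    intro i n hin
    induction n with
    | zero => omega
    | succ n ih =>
      rw [hUs]
      rcases Nat.lt_succ_iff_lt_or_eq.1 hin with h | rfl
      · exact Submodule.mem_sup_left (ih h)
      · exact Submodule.mem_sup_right (Submodule.mem_span_singleton_self _)
  have hperp : ∀ n f, (∀ i < n, ⟪next (U i), f⟫ = 0) → f ∈ (U n)ᗮ := by
    intro n f
    induction n with
    | zero => intro _; rw [hU0]; simp
    | succ n ih =>
      intro h
      rw [hUs, Submodule.mem_orthogonal]
      intro x hx
      obtain ⟨y, hy, z, hz, rfl⟩ := Submodule.mem_sup.1 hx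
      obtain ⟨a, rfl⟩ := Submodule.mem_span_singleton.1 hz
      rw [inner_add_left, real_inner_smul_left, h n (Nat.lt_succ_self n), mul_zero, add_zero]
      exact (Submodule.mem_orthogonal _ _).1 (ih fun i hi => h i (hi.trans (Nat.lt_succ_self n)))
        y hy
  have hu : ∀ n, _ := fun n => hnext (U n) (hU n).1 (hU n).2
  choose h1 h2 τ h3 h4 h5 using hu
  refine ⟨fun n => next (U n), τ, ⟨⟨h2, ?_⟩, h3, h4, fun n f hf => h5 n f (hperp n f hf)⟩⟩
  intro i j hij
  rcases lt_or_gt_of_ne hij with h | h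
  · exact (Submodule.mem_orthogonal _ _).1 (h1 j) _ (hmem i j h)
  · rw [real_inner_comm]
    exact (Submodule.mem_orthogonal _ _).1 (h1 i) _ (hmem j i h)

end IsPosCompact

end Abstract

/-! ### Min-max characterisation of the levels and Ky Fan's inequality -/

section KyFan

variable {H : Type*} [NormedAddCommGroup H] [InnerProductSpace ℝ H]

namespace IsPosCompact

variable {T : H →L[ℝ] H} {u : ℕ → H} {τ : ℕ → ℝ}

theorem IsEigenSeq.antitone (h : IsEigenSeq T u τ) : Antitone τ := by
  refine antitone_nat_of_succ_le fun n => ?_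
  have h1 := h.le n (u (n + 1)) (fun i hi => h.orthonormal.2 (by omega))
  rw [h.apply, real_inner_smul_left, real_inner_self_eq_norm_sq, h.orthonormal.1] at h1
  simpa using h1

theorem IsEigenSeq.inv_monotone (h : IsEigenSeq T u τ) : Monotone fun n => (τ n)⁻¹ :=
  fun _ _ hmn => inv_anti₀ (h.pos _) (h.antitone hmn)

/-- The component of `f` orthogonal to `u 0, …, u (n - 1)`. -/
noncomputable def remainder (u : ℕ → H) (n : ℕ) (f : H) : H :=
  f - ∑ j ∈ Finset.range n, ⟪u j, f⟫ • u j

theorem inner_remainder (hu : Orthonormal ℝ u) (n : ℕ) (f : H) {i : ℕ} (hi : i < n) :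
    ⟪u i, remainder u n f⟫ = 0 := by
  rw [remainder, inner_sub_right, inner_sum, Finset.sum_eq_single i]
  · simp [real_inner_smul_right, hu.1]
  · intro j _ hj
    rw [real_inner_smul_right, hu.2 hj.symm, mul_zero]
  · simp [hi]

/-- The smallest level up to which there are `k + 1` independent eigenvectors of `T⁻¹` is
the inverse of the `k`-th eigenvalue of `T`. -/
theorem isLeast_levels (hT : IsPosCompact T) (h : IsEigenSeq T u τ) (k : ℕ) :
    IsLeast {t : ℝ | ∃ v : Fin (k + 1) → H, LinearIndependent ℝ v ∧
      ∀ i, ∃ ν ≤ t, v i ≠ 0 ∧ ν • T (v i) = v i} (τ k)⁻¹ := by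
  constructor
  · refine ⟨fun i => u i, h.orthonormal.linearIndependent.comp _ Fin.val_injective, fun i =>
      ⟨(τ i)⁻¹, h.inv_monotone (Nat.lt_succ_iff.1 i.2), h.orthonormal.ne_zero _, ?_⟩⟩
    rw [h.apply, smul_smul, inv_mul_cancel₀ (h.pos _).ne', one_smul]
  · rintro t ⟨v, hv, hvt⟩
    -- Below `(τ k)⁻¹` every eigenvector lies in the span of `u 0, …, u (k - 1)`: its remainder
    -- satisfies the same eigenvalue equation, so a nonzero one would have Rayleigh quotient `ν⁻¹ >
    -- τ k`. That span is too small for `k + 1` independent vectors.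
    by_contra! hlt
    have hspan : ∀ i, v i ∈ Submodule.span ℝ (Set.range fun j : Fin k => u j) := by
      intro i
      obtain ⟨ν, hν, h0, hev⟩ := hvt i
      have hcoef : ∀ j, ν • T (⟪u j, v i⟫ • u j) = ⟪u j, v i⟫ • u j := by
        intro j
        have h1 : ⟪u j, v i⟫ = ν * τ j * ⟪u j, v i⟫ := by
          conv_lhs => rw [← hev, real_inner_smul_right, ← hT.symm, h.apply, real_inner_smul_left]
          ring
        conv_rhs => rw [h1]
        rw [map_smul, h.apply, smul_smul, smul_smul]
        congr 1
        ring
      have hr : ν • T (remainder u k (v i)) = remainder u k (v i) := by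
        rw [remainder, map_sub, smul_sub, hev, map_sum, Finset.smul_sum]
        simp only [hcoef]
      have hνpos : 0 < ν := by
        have h1 : ν * ⟪T (v i), v i⟫ = ‖v i‖ ^ 2 := by
          rw [← real_inner_smul_left, hev, real_inner_self_eq_norm_sq]
        have h2 := hT.pos h0
        have h3 : 0 < ‖v i‖ ^ 2 := by have := norm_pos_iff.2 h0; positivity
        rw [← h1] at h3
        exact pos_of_mul_pos_left h3 h2.le
      have hle := h.le k (remainder u k (v i)) fun j hj => inner_remainder h.orthonormal k _ hj
      have h1 : ν * ⟪T (remainder u k (v i)), remainder u k (v i)⟫ =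
          ‖remainder u k (v i)‖ ^ 2 := by
        rw [← real_inner_smul_left, hr, real_inner_self_eq_norm_sq]
      have h2 : ν * τ k < 1 := by
        have := mul_lt_mul_of_pos_right (hν.trans_lt hlt) (h.pos k)
        rwa [inv_mul_cancel₀ (h.pos k).ne'] at this
      have h3 : ‖remainder u k (v i)‖ ^ 2 = 0 := by
        have h4 := mul_le_mul_of_nonneg_left hle hνpos.le
        rw [h1] at h4
        nlinarith [sq_nonneg ‖remainder u k (v i)‖]
      have h4 : remainder u k (v i) = 0 := by simpa using h3
      rw [remainder, sub_eq_zero] at h4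
      rw [h4]
      refine Submodule.sum_mem _ fun j hj => Submodule.smul_mem _ _ (Submodule.subset_span ?_)
      exact ⟨⟨j, Finset.mem_range.1 hj⟩, rfl⟩
    have := FiniteDimensional.span_of_finite ℝ (Set.finite_range fun j : Fin k => u j)
    have h1 := Submodule.finrank_mono (Submodule.span_le.2 (Set.range_subset_iff.2 hspan))
    rw [finrank_span_eq_card hv] at h1
    have h2 := finrank_range_le_card (R := ℝ) (fun j : Fin k => u j)
    rw [Set.finrank] at h2
    simp only [Fintype.card_fin] at h1 h2
    omega

variable {f g : ℕ → H}

/-- The remainder of `T x` is the image of a vector orthogonal to `u 0, …, u (n - 1)`, with explicit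
Rayleigh quotient. -/
theorem inner_remainder_eq (hT : IsPosCompact T) (h : IsEigenSeq T u τ) (n : ℕ) (x : H) :
    ∃ s : H, T s = remainder u n (T x) ∧
      s = x - ∑ j ∈ Finset.range n, ((τ j)⁻¹ * ⟪u j, T x⟫) • u j ∧
      (∀ i < n, ⟪u i, s⟫ = 0) ∧
      ⟪s, T s⟫ = ⟪x, T x⟫ - ∑ j ∈ Finset.range n, (τ j)⁻¹ * ⟪u j, T x⟫ ^ 2 ∧
      ‖T s‖ ^ 2 = ‖T x‖ ^ 2 - ∑ j ∈ Finset.range n, ⟪u j, T x⟫ ^ 2 := by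
  have hux : ∀ j, ⟪u j, x⟫ = (τ j)⁻¹ * ⟪u j, T x⟫ := by
    intro j
    rw [← hT.symm, h.apply, real_inner_smul_left, ← mul_assoc, inv_mul_cancel₀ (h.pos j).ne',
      one_mul]
  have hTs : T (remainder u n x) = remainder u n (T x) := by
    rw [remainder, remainder, map_sub, map_sum]
    congr 1
    refine Finset.sum_congr rfl fun j _ => ?_
    rw [map_smul, h.apply, hux, smul_smul]
    congr 1
    have := (h.pos j).ne'
    field_simp
  have hperp : ∀ y : H, ∀ a : ℕ → ℝ,
      ⟪∑ j ∈ Finset.range n, a j • u j, remainder u n y⟫ = 0 := by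
    intro y a
    rw [sum_inner]
    refine Finset.sum_eq_zero fun j hj => ?_
    rw [real_inner_smul_left, inner_remainder h.orthonormal n y (Finset.mem_range.1 hj), mul_zero]
  refine ⟨remainder u n x, hTs, ?_, fun i hi => inner_remainder h.orthonormal n x hi, ?_, ?_⟩
  · simp only [remainder, hux]
  · rw [hTs]
    conv_lhs => rw [remainder, inner_sub_left, hperp, sub_zero, remainder, inner_sub_right,
      inner_sum]
    congr 1
    refine Finset.sum_congr rfl fun j _ => ?_
    rw [real_inner_smul_right, real_inner_comm (u j) x, hux]
    ring
  · rw [hTs, ← real_inner_self_eq_norm_sq]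
    conv_lhs => rw [remainder, inner_sub_left, ← remainder, hperp, sub_zero, remainder,
      inner_sub_right, inner_sum]
    rw [real_inner_self_eq_norm_sq]
    congr 1
    refine Finset.sum_congr rfl fun j _ => ?_
    rw [real_inner_smul_right, real_inner_comm]
    ring

/-- With `y = T s` this is the lower bound `(τ n)⁻¹‖y‖²` for the form of `T⁻¹` on the complement of
`u 0, …, u (n - 1)`. -/
theorem IsEigenSeq.inv_mul_norm_sq_le (h : IsEigenSeq T u τ) (hT : IsPosCompact T) (n : ℕ) (s : H)
    (hs : ∀ i < n, ⟪u i, s⟫ = 0) : (τ n)⁻¹ * ‖T s‖ ^ 2 ≤ ⟪s, T s⟫ := by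
  have h1 := hT.inner_sq_le s (T s)
  have h2 := h.le n (T s) fun i hi => by
    rw [← hT.symm, h.apply, real_inner_smul_left, hs i hi, mul_zero]
  rw [real_inner_self_eq_norm_sq] at h1
  have h3 := hT.nonneg s
  rw [real_inner_comm] at h3 h1
  have h4 := h1.trans (mul_le_mul_of_nonneg_left h2 h3)
  rw [inv_mul_le_iff₀ (h.pos n)]
  by_cases h0 : ‖T s‖ = 0
  · rw [h0]; simpa using mul_nonneg (h.pos n).le h3
  have h5 : 0 < ‖T s‖ ^ 2 := by positivity
  nlinarith

/-- A zero of the nonnegative form `⟪s, T s⟫ - (τ n)⁻¹‖T s‖²` is a minimiser, so its first variation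
vanishes. In the direction `x = s - (τ n)⁻¹ • T s` that variation is `2⟪T x, x⟫`, whence `x = 0`. -/
theorem IsEigenSeq.eq_smul_of_eq (h : IsEigenSeq T u τ) (hT : IsPosCompact T) (n : ℕ) (s : H)
    (hs : ∀ i < n, ⟪u i, s⟫ = 0) (heq : (τ n)⁻¹ * ‖T s‖ ^ 2 = ⟪s, T s⟫) :
    s = (τ n)⁻¹ • T s := by
  set lam := (τ n)⁻¹ with hlam
  set x := s - lam • T s with hx
  have hTs : ∀ i < n, ⟪u i, T s⟫ = 0 := fun i hi => by
    rw [← hT.symm, h.apply, real_inner_smul_left, hs i hi, mul_zero]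
  have hxp : ∀ i < n, ⟪u i, x⟫ = 0 := fun i hi => by
    rw [hx, inner_sub_right, real_inner_smul_right, hs i hi, hTs i hi, mul_zero, sub_zero]
  have hcross : ⟪s, T x⟫ - lam * ⟪T s, T x⟫ = ⟪T x, x⟫ := by
    conv_rhs => rw [hx, inner_sub_right, real_inner_smul_right]
    rw [real_inner_comm s, real_inner_comm (T s)]
  have hquad : ∀ t : ℝ, 0 ≤ (⟪x, T x⟫ - lam * ‖T x‖ ^ 2) * (t * t) + (2 * ⟪T x, x⟫) * t + 0 := by
    intro t
    have h1 := h.inv_mul_norm_sq_le hT n (s + t • x) fun i hi => by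
      rw [inner_add_right, real_inner_smul_right, hs i hi, hxp i hi, mul_zero, add_zero]
    have h2 : ⟪x, T s⟫ = ⟪s, T x⟫ := by rw [← hT.symm, real_inner_comm]
    rw [map_add, map_smul, norm_add_sq_real, norm_smul, mul_pow, Real.norm_eq_abs, sq_abs] at h1
    simp only [inner_add_left, inner_add_right, real_inner_smul_left, real_inner_smul_right] at h1
    rw [h2, ← hlam] at h1
    rw [← hcross]
    linarith
  have h1 := discrim_le_zero hquad
  have h2 : ⟪T x, x⟫ = 0 := by
    unfold discrim at h1
    nlinarith
  have h3 : x = 0 := by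
    by_contra h0
    exact (hT.pos h0).ne' h2
  exact sub_eq_zero.1 h3

/-- Ky Fan's inequality for `T⁻¹` together with its equality case. -/
theorem kyFan (hT : IsPosCompact T) (h : IsEigenSeq T u τ) (hf : Orthonormal ℝ f)
    (hg : ∀ i, T (g i) = f i) (n : ℕ) :
    (∑ k ∈ Finset.range (n + 1), (τ k)⁻¹ ≤ ∑ i ∈ Finset.range (n + 1), ⟪g i, f i⟫) ∧
    (∑ k ∈ Finset.range (n + 1), (τ k)⁻¹ = ∑ i ∈ Finset.range (n + 1), ⟪g i, f i⟫ →
      ∀ y, (∀ i ∈ Finset.range (n + 1), ⟪f i, y⟫ = 0) →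
        ∀ i ∈ Finset.range (n + 1), ⟪g i, y⟫ = 0) := by
  choose s hs1 hs2 hs3 hs4 hs5 using fun i => hT.inner_remainder_eq h n (g i)
  simp only [hg] at hs1 hs2 hs4 hs5
  -- `w j` is the squared length of the projection of `u j` onto the span of the `f i`, at most `1`
  -- by Bessel.
  set w : ℕ → ℝ := fun j => ∑ i ∈ Finset.range (n + 1), ⟪u j, f i⟫ ^ 2 with hw
  have hw1 : ∀ j, w j ≤ 1 := by
    intro j
    have := hf.sum_inner_products_le (u j) (s := Finset.range (n + 1))
    simp only [Real.norm_eq_abs, sq_abs, h.orthonormal.1, one_pow] at this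
    simpa only [hw, real_inner_comm] using this
  have hdef1 : ∀ i, 0 ≤ ⟪s i, T (s i)⟫ - (τ n)⁻¹ * ‖T (s i)‖ ^ 2 := fun i =>
    sub_nonneg.2 (h.inv_mul_norm_sq_le hT n (s i) (hs3 i))
  have hdef2 : ∀ j ∈ Finset.range n, 0 ≤ ((τ n)⁻¹ - (τ j)⁻¹) * (1 - w j) := fun j hj =>
    mul_nonneg (sub_nonneg.2 (h.inv_monotone (Finset.mem_range.1 hj).le)) (sub_nonneg.2 (hw1 j))
  -- The gap in Ky Fan's inequality, written exactly as a sum of nonnegative defects; each must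
  -- vanish in the equality case.
  have hid : ∑ i ∈ Finset.range (n + 1), ⟪g i, f i⟫ - ∑ k ∈ Finset.range (n + 1), (τ k)⁻¹ =
      ∑ i ∈ Finset.range (n + 1), (⟪s i, T (s i)⟫ - (τ n)⁻¹ * ‖T (s i)‖ ^ 2) +
        ∑ j ∈ Finset.range n, ((τ n)⁻¹ - (τ j)⁻¹) * (1 - w j) := by
    have e1 : ∀ i, ⟪s i, T (s i)⟫ - (τ n)⁻¹ * ‖T (s i)‖ ^ 2 = ⟪g i, f i⟫ - (τ n)⁻¹ +
        ∑ j ∈ Finset.range n, ((τ n)⁻¹ - (τ j)⁻¹) * ⟪u j, f i⟫ ^ 2 := by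
      intro i
      rw [hs4, hs5, hf.1]
      simp only [sub_mul, Finset.sum_sub_distrib, ← Finset.mul_sum]
      ring
    simp only [e1, Finset.sum_add_distrib, Finset.sum_sub_distrib, Finset.sum_const,
      Finset.card_range]
    rw [Finset.sum_comm]
    simp only [← Finset.mul_sum, mul_sub, mul_one, Finset.sum_sub_distrib, Finset.sum_const,
      Finset.card_range, nsmul_eq_mul, Finset.sum_range_succ (fun k => (τ k)⁻¹)]
    push_cast
    ring
  refine ⟨?_, ?_⟩
  · rw [← sub_nonneg, hid]
    exact add_nonneg (Finset.sum_nonneg fun i _ => hdef1 i) (Finset.sum_nonneg hdef2)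
  · intro heq y hy i hi
    rw [heq, sub_self] at hid
    have hz1 := (add_eq_zero_iff_of_nonneg (Finset.sum_nonneg fun i _ => hdef1 i)
      (Finset.sum_nonneg hdef2)).1 hid.symm
    have hz2 := (Finset.sum_eq_zero_iff_of_nonneg fun i _ => hdef1 i).1 hz1.1
    have hz3 := (Finset.sum_eq_zero_iff_of_nonneg hdef2).1 hz1.2
    -- Either the two eigenvalues agree, or `w j = 1`, so that `u j` lies in the span of the `f i`
    -- and is orthogonal to `y`.
    have hu : ∀ j ∈ Finset.range n, ((τ n)⁻¹ - (τ j)⁻¹) * ⟪u j, y⟫ = 0 := by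
      intro j hj
      rcases mul_eq_zero.1 (hz3 j hj) with h0 | h0
      · rw [h0, zero_mul]
      have hexp : u j = ∑ i ∈ Finset.range (n + 1), ⟪f i, u j⟫ • f i := by
        have hsq : ‖u j - ∑ i ∈ Finset.range (n + 1), ⟪f i, u j⟫ • f i‖ ^ 2 = 1 - w j := by
          have e1 : ⟪∑ i ∈ Finset.range (n + 1), ⟪f i, u j⟫ • f i,
              ∑ i ∈ Finset.range (n + 1), ⟪f i, u j⟫ • f i⟫ = w j := by
            rw [hf.inner_sum]
            simp [hw, sq, real_inner_comm]
          have e2 : ⟪u j, ∑ i ∈ Finset.range (n + 1), ⟪f i, u j⟫ • f i⟫ = w j := by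
            rw [inner_sum]
            simp [hw, sq, real_inner_smul_right, real_inner_comm]
          rw [norm_sub_sq_real, e2, ← real_inner_self_eq_norm_sq (∑ i ∈ _, _), e1,
            h.orthonormal.1]
          ring
        rw [h0] at hsq
        exact sub_eq_zero.1 (by simpa using hsq)
      rw [hexp, sum_inner, Finset.sum_eq_zero, mul_zero]
      intro i hi
      rw [real_inner_smul_left, hy i hi, mul_zero]
    have hsi : s i = (τ n)⁻¹ • T (s i) :=
      h.eq_smul_of_eq hT n (s i) (hs3 i) (sub_eq_zero.1 (hz2 i hi)).symm
    have hgi : g i = s i + ∑ j ∈ Finset.range n, ((τ j)⁻¹ * ⟪u j, f i⟫) • u j := by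
      rw [hs2 i]; abel
    rw [hgi, hsi, hs1, remainder, inner_add_left, real_inner_smul_left, inner_sub_left, hy i hi,
      sum_inner, sum_inner, zero_sub, mul_neg, Finset.mul_sum, neg_add_eq_sub,
      ← Finset.sum_sub_distrib]
    refine Finset.sum_eq_zero fun j hj => ?_
    rw [real_inner_smul_left, real_inner_smul_left]
    linear_combination -⟪u j, f i⟫ * hu j hj

end IsPosCompact

end KyFan

/-! ### Diagonal operators and inversion of their bounded perturbations -/

section Diagonal

variable {H : Type*} [NormedAddCommGroup H] [InnerProductSpace ℝ H]

theorem hilbertBasis_ext {e : HilbertBasis ℕ ℝ H} {x y : H} (h : ∀ k, ⟪e k, x⟫ = ⟪e k, y⟫) : x = y := by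
  refine e.repr.injective (lp.ext (funext fun k => ?_))
  rw [e.repr_apply_apply, e.repr_apply_apply, h]

variable [CompleteSpace H]

/-- The operator with eigenvalues `d k` along the Hilbert basis `e`. -/
noncomputable def diagOp (e : HilbertBasis ℕ ℝ H) (d : ℕ → ℝ) : H →L[ℝ] H :=
  ∑' k, d k • InnerProductSpace.rankOne ℝ (e k) (e k)

variable {e : HilbertBasis ℕ ℝ H} {d : ℕ → ℝ}

theorem hasSum_diagOp (hd : Summable d) :
    HasSum (fun k => d k • InnerProductSpace.rankOne ℝ (e k) (e k)) (diagOp e d) := by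
  refine (Summable.of_norm_bounded (g := fun k => |d k|) hd.abs fun k => ?_).hasSum
  rw [norm_smul, InnerProductSpace.norm_rankOne, e.orthonormal.1, Real.norm_eq_abs, mul_one,
    mul_one]

theorem inner_diagOp (hd : Summable d) (x : H) (k : ℕ) :
    ⟪e k, diagOp e d x⟫ = d k * ⟪e k, x⟫ := by
  have h1 := ((hasSum_diagOp (e := e) hd).mapL (ContinuousLinearMap.apply ℝ H x)).mapL
    (innerSL ℝ (e k))
  refine h1.unique ?_
  convert hasSum_single k ?_ using 1
  · simp [InnerProductSpace.rankOne_apply, e.orthonormal.1]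
  · intro j hj
    simp [InnerProductSpace.rankOne_apply, e.orthonormal.2 hj.symm]

/-- A norm limit of finite-rank operators. -/
theorem isCompactOperator_diagOp (hd : Summable d) : IsCompactOperator (diagOp e d) := by
  refine isCompactOperator_of_tendsto (hasSum_diagOp (e := e) hd) (Eventually.of_forall fun s => ?_)
  refine Submodule.sum_mem (compactOperator (RingHom.id ℝ) H H) fun k _ => ?_
  refine Submodule.smul_mem _ _ ?_
  change IsCompactOperator _
  refine ⟨(fun a : ℝ => a • e k) '' Metric.closedBall 0 1,
    (isCompact_closedBall _ _).image (by fun_prop), ?_⟩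
  filter_upwards [Metric.ball_mem_nhds (0 : H) one_pos] with x hx
  refine ⟨⟪e k, x⟫, ?_, by simp [InnerProductSpace.rankOne_apply]⟩
  rw [mem_closedBall_zero_iff]
  rw [mem_ball_zero_iff] at hx
  refine (norm_inner_le_norm _ _).trans ?_
  rw [e.orthonormal.1, one_mul]
  exact hx.le

theorem diagOp_symm (hd : Summable d) (x y : H) : ⟪diagOp e d x, y⟫ = ⟪x, diagOp e d y⟫ := by
  refine (e.hasSum_inner_mul_inner _ _).unique ?_
  convert e.hasSum_inner_mul_inner x (diagOp e d y) using 2 with k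
  rw [inner_diagOp hd, real_inner_comm, inner_diagOp hd, real_inner_comm x]
  ring

theorem mul_norm_diagOp_sq_le (hd : Summable d) (hd0 : ∀ k, 0 ≤ d k) {c : ℝ}
    (hdc : ∀ k, c * d k ≤ 1) (x : H) : c * ‖diagOp e d x‖ ^ 2 ≤ ⟪diagOp e d x, x⟫ := by
  rw [← real_inner_self_eq_norm_sq]
  refine hasSum_le (fun k => ?_)
    ((e.hasSum_inner_mul_inner (diagOp e d x) (diagOp e d x)).mul_left c)
    (e.hasSum_inner_mul_inner (diagOp e d x) x)
  rw [real_inner_comm, inner_diagOp hd]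
  have := mul_le_mul_of_nonneg_right (hdc k) (mul_nonneg (hd0 k) (sq_nonneg ⟪e k, x⟫))
  linarith

theorem norm_diagOp_le (hd : Summable d) (hd0 : ∀ k, 0 ≤ d k) {c : ℝ} (hc : 0 < c)
    (hdc : ∀ k, c * d k ≤ 1) : ‖diagOp e d‖ ≤ c⁻¹ := by
  refine ContinuousLinearMap.opNorm_le_bound _ (by positivity) fun x => ?_
  have h1 := (mul_norm_diagOp_sq_le (e := e) hd hd0 hdc x).trans (real_inner_le_norm _ _)
  rw [le_inv_mul_iff₀ hc]
  by_cases h0 : ‖diagOp e d x‖ = 0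
  · rw [h0]; simp
  have : 0 < ‖diagOp e d x‖ := by positivity
  nlinarith

/-- The inverse of a bounded symmetric perturbation of a diagonal operator with summable inverse
eigenvalues. -/
theorem exists_resolvent (e : HilbertBasis ℕ ℝ H) (hd : Summable d) (hd0 : ∀ k, 0 < d k) {c : ℝ}
    (hdc : ∀ k, c * d k ≤ 1) {Q : H →L[ℝ] H} (hQ : ∀ x y, ⟪Q x, y⟫ = ⟪x, Q y⟫) (hQc : ‖Q‖ < c) :
    ∃ T : H →L[ℝ] H, IsPosCompact T ∧
      ∀ y u, T y = u ↔ ∀ k, (d k)⁻¹ * ⟪e k, u⟫ + ⟪e k, Q u⟫ = ⟪e k, y⟫ := by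
  have hc : 0 < c := (norm_nonneg Q).trans_lt hQc
  set R := diagOp e d with hR
  have hRn : ‖R‖ ≤ c⁻¹ := norm_diagOp_le hd (fun k => (hd0 k).le) hc hdc
  -- With `R` the inverse of the diagonal part `D`, one has `D + Q = (1 + Q R) D`; the Neumann
  -- series inverts `1 + Q R`, and `T = R (1 + Q R)⁻¹`.
  have hlt : ‖-(Q * R)‖ < 1 := by
    rw [norm_neg]
    calc ‖Q * R‖ ≤ ‖Q‖ * ‖R‖ := norm_mul_le _ _
      _ ≤ ‖Q‖ * c⁻¹ := by gcongr
      _ < c * c⁻¹ := by gcongr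
      _ = 1 := mul_inv_cancel₀ hc.ne'
  obtain ⟨N, hN⟩ := isUnit_one_sub_of_norm_lt_one hlt
  have hNapp : ∀ h, (N : H →L[ℝ] H) h = h + Q (R h) := by
    intro h; rw [hN]; simp
  set N' : H →L[ℝ] H := ((N⁻¹ : (H →L[ℝ] H)ˣ) : H →L[ℝ] H) with hN'
  have hNN' : ∀ y, N' y + Q (R (N' y)) = y := by
    intro y
    rw [← hNapp]
    exact congrArg (fun A : H →L[ℝ] H => A y) N.mul_inv
  have hN'N : ∀ y, N' (y + Q (R y)) = y := by
    intro y
    rw [← hNapp]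
    exact congrArg (fun A : H →L[ℝ] H => A y) N.inv_mul
  have hchar : ∀ y u, (R ∘L N') y = u ↔ ∀ k, (d k)⁻¹ * ⟪e k, u⟫ + ⟪e k, Q u⟫ = ⟪e k, y⟫ := by
    intro y u
    constructor
    · rintro rfl k
      conv_rhs => rw [← hNN' y, inner_add_right]
      rw [ContinuousLinearMap.comp_apply, hR, inner_diagOp hd, ← mul_assoc,
        inv_mul_cancel₀ (hd0 k).ne', one_mul]
    · intro h
      have hu : R (y - Q u) = u := by
        refine hilbertBasis_ext (e := e) fun k => ?_
        rw [hR, inner_diagOp hd, inner_sub_right, ← h k, add_sub_cancel_right, ← mul_assoc,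
          mul_inv_cancel₀ (hd0 k).ne', one_mul]
      have h1 := hN'N (y - Q u)
      rw [hu, sub_add_cancel] at h1
      rw [ContinuousLinearMap.comp_apply, h1, hu]
  refine ⟨R ∘L N', ⟨fun x y => ?_, fun x => ?_, fun x hx => ?_, ?_⟩, hchar⟩
  · conv_lhs => rw [← hNN' y]
    conv_rhs => rw [← hNN' x]
    simp only [ContinuousLinearMap.comp_apply, inner_add_left, inner_add_right]
    rw [hQ, hR, diagOp_symm hd]
  -- With `z = N' x` the form is at least `(c - ‖Q‖)‖R z‖²`.
  · have h0 : ⟪(R ∘L N') x, x⟫ = ⟪R (N' x), N' x + Q (R (N' x))⟫ := by rw [hNN']; rfl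
    rw [h0, inner_add_right]
    have h1 := mul_norm_diagOp_sq_le (e := e) hd (fun k => (hd0 k).le) hdc (N' x)
    have h2 := (abs_le.1 (abs_real_inner_le_norm (R (N' x)) (Q (R (N' x))))).1
    have h3 := mul_le_mul_of_nonneg_left (Q.le_opNorm (R (N' x))) (norm_nonneg (R (N' x)))
    have h4 := mul_le_mul_of_nonneg_right hQc.le (sq_nonneg ‖R (N' x)‖)
    rw [← hR] at h1
    linarith
  · refine hilbertBasis_ext (e := e) fun k => ?_
    have := (hchar x 0).1 hx k
    simpa using this.symm
  · exact (isCompactOperator_diagOp hd).comp_clm N'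

end Diagonal

/-! ### The cosine Hilbert basis of `L²(0, π)` -/

section Cosine

theorem exists_bound_Ioo (f : C(ℝ, ℝ)) :
    ∃ C, 0 ≤ C ∧ ∀ x ∈ Set.Ioo (0 : ℝ) π, |f x| ≤ C := by
  obtain ⟨C, hC⟩ := (isCompact_Icc (a := (0 : ℝ)) (b := π)).exists_bound_of_continuousOn
    f.continuous.continuousOn
  refine ⟨max C 0, le_max_right _ _, fun x hx => (hC x (Set.Ioo_subset_Icc_self hx)).trans ?_⟩
  exact le_max_left _ _

theorem memLp_Ioo (f : C(ℝ, ℝ)) : MemLp f 2 (volume.restrict (Set.Ioo (0 : ℝ) π)) := by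
  obtain ⟨C, -, hC⟩ := exists_bound_Ioo f
  exact MemLp.of_bound f.continuous.aestronglyMeasurable C
    ((ae_restrict_iff' measurableSet_Ioo).2 (Eventually.of_forall hC))

/-- The class in `L²(0, π)` of a continuous function. -/
noncomputable def toL2 : C(ℝ, ℝ) →ₗ[ℝ] L2 where
  toFun f := (memLp_Ioo f).toLp f
  map_add' f g := MemLp.toLp_add (memLp_Ioo f) (memLp_Ioo g)
  map_smul' c f := MemLp.toLp_const_smul c (memLp_Ioo f)

theorem coeFn_toL2 (f : C(ℝ, ℝ)) :
    toL2 f =ᵐ[volume.restrict (Set.Ioo (0 : ℝ) π)] f :=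
  MemLp.coeFn_toLp (memLp_Ioo f)

theorem inner_L2 (u v : L2) : ⟪u, v⟫ = ∫ x in Set.Ioo (0 : ℝ) π, u x * v x := by
  rw [L2.inner_def]
  exact integral_congr_ae (Eventually.of_forall fun x => by simp [mul_comm])

theorem inner_toL2_left (f : C(ℝ, ℝ)) (u : L2) :
    ⟪toL2 f, u⟫ = ∫ x in Set.Ioo (0 : ℝ) π, f x * u x := by
  rw [inner_L2]
  refine integral_congr_ae ?_
  filter_upwards [coeFn_toL2 f] with x hx
  rw [hx]

theorem integral_Ioo_eq (f : ℝ → ℝ) :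
    ∫ x in Set.Ioo (0 : ℝ) π, f x = ∫ x in (0 : ℝ)..π, f x := by
  rw [intervalIntegral.integral_of_le pi_pos.le, integral_Ioc_eq_integral_Ioo]

theorem inner_toL2_toL2 (f g : C(ℝ, ℝ)) : ⟪toL2 f, toL2 g⟫ = ∫ x in (0 : ℝ)..π, f x * g x := by
  rw [inner_toL2_left, ← integral_Ioo_eq]
  refine integral_congr_ae ?_
  filter_upwards [coeFn_toL2 g] with x hx
  rw [hx]

theorem norm_toL2_le (f : C(ℝ, ℝ)) {ε : ℝ} (hε : 0 ≤ ε) (h : ∀ x ∈ Set.Ioo (0 : ℝ) π, |f x| ≤ ε) :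
    ‖toL2 f‖ ≤ √π * ε := by
  have h1 : ‖toL2 f‖ ^ 2 ≤ π * ε ^ 2 := by
    rw [← real_inner_self_eq_norm_sq, inner_toL2_toL2]
    have h2 : ∫ x in (0 : ℝ)..π, f x * f x ≤ ∫ x in (0 : ℝ)..π, ε ^ 2 := by
      refine intervalIntegral.integral_mono_on_of_le_Ioo pi_pos.le
        (Continuous.intervalIntegrable (by fun_prop) _ _)
        (Continuous.intervalIntegrable (by fun_prop) _ _) fun x hx => ?_
      rw [← sq, ← sq_abs]
      exact pow_le_pow_left₀ (abs_nonneg _) (h x hx) 2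
    simpa using h2
  refine abs_le_of_sq_le_sq' ?_ (by positivity) |>.2
  rw [mul_pow, Real.sq_sqrt pi_pos.le]
  exact h1

/-- The function `cos (k x)`. -/
noncomputable def cosMap (k : ℕ) : C(ℝ, ℝ) := ⟨fun x => cos (k * x), by fun_prop⟩

/-- The function `sin (k x)`. -/
noncomputable def sinMap (k : ℕ) : C(ℝ, ℝ) := ⟨fun x => sin (k * x), by fun_prop⟩

@[simp] theorem cosMap_apply (k : ℕ) (x : ℝ) : cosMap k x = cos (k * x) := rfl

@[simp] theorem sinMap_apply (k : ℕ) (x : ℝ) : sinMap k x = sin (k * x) := rfl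

theorem integral_cos_int (j : ℤ) :
    ∫ x in (0 : ℝ)..π, cos (j * x) = if j = 0 then π else 0 := by
  split_ifs with h
  · simp [h]
  · have : (j : ℝ) ≠ 0 := Int.cast_ne_zero.2 h
    rw [intervalIntegral.integral_comp_mul_left (fun x => cos x) this]
    simp [integral_cos, Real.sin_int_mul_pi]

theorem cos_mul_cos_nat (k m : ℕ) (x : ℝ) :
    cos (k * x) * cos (m * x) =
      (cos (((k : ℤ) - m : ℤ) * x) + cos (((k : ℤ) + m : ℤ) * x)) / 2 := by
  push_cast
  rw [sub_mul, add_mul, cos_sub, cos_add]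
  ring

theorem inner_cosMap (k m : ℕ) :
    ⟪toL2 (cosMap k), toL2 (cosMap m)⟫ = if k = m then (if k = 0 then π else π / 2) else 0 := by
  rw [inner_toL2_toL2]
  simp only [cosMap_apply, cos_mul_cos_nat]
  rw [intervalIntegral.integral_div, intervalIntegral.integral_add
    (Continuous.intervalIntegrable (by fun_prop) _ _)
    (Continuous.intervalIntegrable (by fun_prop) _ _), integral_cos_int, integral_cos_int]
  by_cases h : k = m
  · subst h
    by_cases h0 : k = 0
    · simp [h0]
    · have : ¬ ((k : ℤ) + k = 0) := by omega
      simp [h0, this]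
  · have h1 : ¬ ((k : ℤ) - m = 0) := by omega
    have h2 : ¬ ((k : ℤ) + m = 0) := by omega
    simp [h, h1, h2]

/-- The normalising constant of `cos (k x)` in `L²(0, π)`. -/
noncomputable def cosNorm (k : ℕ) : ℝ := √(if k = 0 then π⁻¹ else 2 / π)

theorem cosNorm_pos (k : ℕ) : 0 < cosNorm k := by
  have := pi_pos
  unfold cosNorm
  split_ifs <;> positivity

theorem cosNorm_sq (k : ℕ) : cosNorm k ^ 2 = if k = 0 then π⁻¹ else 2 / π := by
  have := pi_pos
  unfold cosNorm
  split_ifs <;> exact Real.sq_sqrt (by positivity)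

theorem orthonormal_cos : Orthonormal ℝ fun k => cosNorm k • toL2 (cosMap k) := by
  rw [orthonormal_iff_ite]
  intro i j
  have := pi_pos
  rw [real_inner_smul_left, real_inner_smul_right, inner_cosMap]
  by_cases h : i = j
  · subst h
    rw [if_pos rfl, if_pos rfl, ← mul_assoc, ← sq, cosNorm_sq]
    split_ifs <;> field_simp
  · simp [h]

theorem mul_cosMap_mem_span (f : C(ℝ, ℝ)) (hf : f ∈ Submodule.span ℝ (Set.range cosMap)) :
    cosMap 1 * f ∈ Submodule.span ℝ (Set.range cosMap) := by
  induction hf using Submodule.span_induction with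
  | mem x hx =>
    obtain ⟨k, rfl⟩ := hx
    rcases k with _ | k
    · refine Submodule.subset_span ⟨1, ?_⟩
      ext x; simp
    · have : cosMap 1 * cosMap (k + 1) = (1 / 2 : ℝ) • (cosMap (k + 2) + cosMap k) := by
        ext x
        simp only [ContinuousMap.mul_apply, ContinuousMap.smul_apply, ContinuousMap.add_apply,
          cosMap_apply, smul_eq_mul]
        have e1 : ((k + 2 : ℕ) : ℝ) * x = (k + 1 : ℕ) * x + x := by push_cast; ring
        have e2 : (k : ℝ) * x = (k + 1 : ℕ) * x - x := by push_cast; ring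
        rw [e1, e2, cos_add, cos_sub, Nat.cast_one, one_mul]
        ring
      rw [this]
      exact Submodule.smul_mem _ _ (Submodule.add_mem _ (Submodule.subset_span ⟨_, rfl⟩)
        (Submodule.subset_span ⟨_, rfl⟩))
  | zero => simp
  | add x y _ _ hx hy => rw [mul_add]; exact Submodule.add_mem _ hx hy
  | smul a x _ hx => rw [mul_smul_comm]; exact Submodule.smul_mem _ _ hx

theorem aeval_cosMap_mem_span (p : Polynomial ℝ) :
    Polynomial.aeval (cosMap 1) p ∈ Submodule.span ℝ (Set.range cosMap) := by
  induction p using Polynomial.induction_on' with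
  | add p q hp hq => rw [map_add]; exact Submodule.add_mem _ hp hq
  | monomial n a =>
    rw [Polynomial.aeval_monomial, ← Algebra.smul_def]
    refine Submodule.smul_mem _ _ ?_
    induction n with
    | zero =>
      refine Submodule.subset_span ⟨0, ?_⟩
      ext x; simp
    | succ n ih => rw [pow_succ']; exact mul_cosMap_mem_span _ ih

/-- Weierstrass approximation of `f ∘ arccos` on `[-1, 1]`: a polynomial in `cos x` is a combination
of the `cos (k x)`. -/
theorem toL2_mem_closure (f : C(ℝ, ℝ)) :
    toL2 f ∈ closure (Submodule.span ℝ (Set.range fun k => cosNorm k • toL2 (cosMap k)) :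
      Set L2) := by
  have hmap : ∀ g ∈ Submodule.span ℝ (Set.range cosMap),
      toL2 g ∈ Submodule.span ℝ (Set.range fun k => cosNorm k • toL2 (cosMap k)) := by
    intro g hg
    have h1 : Submodule.span ℝ (Set.range cosMap) ≤
        (Submodule.span ℝ (Set.range fun k => cosNorm k • toL2 (cosMap k))).comap toL2 := by
      rw [Submodule.span_le]
      rintro _ ⟨k, rfl⟩
      rw [SetLike.mem_coe, Submodule.mem_comap]
      have : toL2 (cosMap k) = (cosNorm k)⁻¹ • cosNorm k • toL2 (cosMap k) := by
        rw [smul_smul, inv_mul_cancel₀ (cosNorm_pos k).ne', one_smul]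
      rw [this]
      exact Submodule.smul_mem _ _ (Submodule.subset_span ⟨k, rfl⟩)
    exact h1 hg
  rw [Metric.mem_closure_iff]
  intro ε hε
  have hpi := pi_pos
  have hδ : 0 < ε / (2 * √π) := by positivity
  obtain ⟨p, hp⟩ := exists_polynomial_near_of_continuousOn (-1) 1 (fun y => f (arccos y))
    (f.continuous.comp continuous_arccos).continuousOn _ hδ
  refine ⟨_, hmap _ (aeval_cosMap_mem_span p), ?_⟩
  rw [dist_eq_norm, ← map_sub]
  have h1 := norm_toL2_le (f - Polynomial.aeval (cosMap 1) p) hδ.le fun x hx => by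
    have h2 := hp (cos x) ⟨neg_one_le_cos x, cos_le_one x⟩
    rw [arccos_cos hx.1.le hx.2.le, abs_sub_comm] at h2
    have h3 : (Polynomial.aeval (cosMap 1) p) x = p.eval (cos x) := by
      have := Polynomial.aeval_continuousMap_apply p (cosMap 1) x
      rw [this]
      simp
    rw [ContinuousMap.sub_apply, h3]
    exact h2.le
  refine h1.trans_lt ?_
  have : √π * (ε / (2 * √π)) = ε / 2 := by
    have : √π ≠ 0 := (Real.sqrt_pos.2 hpi).ne'
    field_simp
  linarith

/-- The normalised cosines form a Hilbert basis of `L²(0, π)`. -/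
noncomputable def cosBasis : HilbertBasis ℕ ℝ L2 :=
  HilbertBasis.mk orthonormal_cos (by
    have h1 := BoundedContinuousFunction.toLp_denseRange ℝ
      (volume.restrict (Set.Ioo (0 : ℝ) π)) (p := 2) ℝ (by norm_num)
    intro u _
    rw [← SetLike.mem_coe, Submodule.topologicalClosure_coe]
    refine closure_minimal ?_ isClosed_closure (h1 u)
    rintro _ ⟨g, rfl⟩
    exact toL2_mem_closure g.toContinuousMap)

theorem cosBasis_apply (k : ℕ) : cosBasis k = cosNorm k • toL2 (cosMap k) := by
  rw [cosBasis, HilbertBasis.coe_mk]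

end Cosine

/-! ### Weak derivatives and the eigenvalue equation in cosine coordinates -/

section WeakDerivative

theorem memLp_mul (f : C(ℝ, ℝ)) (u : L2) :
    MemLp (fun x => f x * u x) 2 (volume.restrict (Set.Ioo (0 : ℝ) π)) := by
  obtain ⟨C, -, hC⟩ := exists_bound_Ioo f
  refine MemLp.of_le_mul (c := C) (Lp.memLp u)
    (f.continuous.aestronglyMeasurable.mul (Lp.aestronglyMeasurable u)) ?_
  refine (ae_restrict_iff' measurableSet_Ioo).2 (Eventually.of_forall fun x hx => ?_)
  rw [norm_mul]
  exact mul_le_mul_of_nonneg_right (hC x hx) (norm_nonneg _)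

/-- Multiplication by a continuous function, as a bounded operator on `L²(0, π)`. -/
theorem exists_mulOp (f : C(ℝ, ℝ)) : ∃ Q : L2 →L[ℝ] L2, ∀ u : L2,
    Q u =ᵐ[volume.restrict (Set.Ioo (0 : ℝ) π)] fun x => f x * u x := by
  obtain ⟨C, -, hC⟩ := exists_bound_Ioo f
  let Q : L2 →ₗ[ℝ] L2 :=
    { toFun := fun u => (memLp_mul f u).toLp _
      map_add' := fun u v => by
        rw [← MemLp.toLp_add, MemLp.toLp_eq_toLp_iff]
        filter_upwards [Lp.coeFn_add u v] with x hx
        rw [hx, Pi.add_apply, Pi.add_apply, mul_add]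
      map_smul' := fun c u => by
        rw [RingHom.id_apply, ← MemLp.toLp_const_smul, MemLp.toLp_eq_toLp_iff]
        filter_upwards [Lp.coeFn_smul c u] with x hx
        rw [hx, Pi.smul_apply, Pi.smul_apply, smul_eq_mul, smul_eq_mul]
        ring }
  have hQ : ∀ u : L2, Q u =ᵐ[volume.restrict (Set.Ioo (0 : ℝ) π)] fun x => f x * u x :=
    fun u => MemLp.coeFn_toLp (memLp_mul f u)
  refine ⟨Q.mkContinuous C fun u => ?_, hQ⟩
  refine Lp.norm_le_mul_norm_of_ae_le_mul ?_
  filter_upwards [hQ u, ae_restrict_mem measurableSet_Ioo] with x hx hxI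
  rw [hx, norm_mul]
  exact mul_le_mul_of_nonneg_right (hC x hxI) (norm_nonneg _)

theorem hasWeakDeriv_iff {u v : L2} : HasWeakDeriv u v ↔
    ∀ φ φ' : C(ℝ, ℝ), ContDiff ℝ ∞ φ → HasCompactSupport φ → tsupport φ ⊆ Set.Ioo 0 π →
      (∀ x, deriv φ x = φ' x) → ⟪toL2 φ', u⟫ = -⟪toL2 φ, v⟫ := by
  constructor
  · intro h φ φ' h1 h2 h3 h4
    have := h φ h1 h2 h3
    rw [inner_toL2_left, inner_toL2_left]
    simpa only [h4, mul_comm] using this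
  · intro h φ h1 h2 h3
    have := h ⟨φ, h1.continuous⟩ ⟨deriv φ, h1.continuous_deriv (by simp)⟩ h1 h2 h3
      fun _ => rfl
    rw [inner_toL2_left, inner_toL2_left] at this
    simpa only [mul_comm, ContinuousMap.coe_mk] using this

theorem HasWeakDeriv.smul {u v : L2} (h : HasWeakDeriv u v) (c : ℝ) :
    HasWeakDeriv (c • u) (c • v) := by
  rw [hasWeakDeriv_iff] at h ⊢
  intro φ φ' h1 h2 h3 h4
  rw [real_inner_smul_right, real_inner_smul_right, h φ φ' h1 h2 h3 h4, mul_neg]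

/-- The weak derivative is a closed operator; this permits differentiating a cosine series term by
term. -/
theorem HasWeakDeriv.hasSum {f g : ℕ → L2} {u v : L2} (h : ∀ k, HasWeakDeriv (f k) (g k))
    (hf : HasSum f u) (hg : HasSum g v) : HasWeakDeriv u v := by
  rw [hasWeakDeriv_iff]
  intro φ φ' h1 h2 h3 h4
  have e1 := hf.mapL (innerSL ℝ (toL2 φ'))
  have e2 := (hg.mapL (innerSL ℝ (toL2 φ))).neg
  simp only [innerSL_apply_apply] at e1 e2
  simp only [fun k => hasWeakDeriv_iff.1 (h k) φ φ' h1 h2 h3 h4] at e1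
  exact e1.unique e2

theorem hasDerivAt_cosMap (k : ℕ) (x : ℝ) :
    HasDerivAt (fun y => cos (k * y)) (-(k * sin (k * x))) x := by
  have := ((hasDerivAt_id x).const_mul (k : ℝ)).cos
  simpa [mul_comm] using this

theorem hasDerivAt_sinMap (k : ℕ) (x : ℝ) :
    HasDerivAt (fun y => sin (k * y)) (k * cos (k * x)) x := by
  have := ((hasDerivAt_id x).const_mul (k : ℝ)).sin
  simpa [mul_comm] using this

theorem hasWeakDeriv_cosMap (k : ℕ) :
    HasWeakDeriv (toL2 (cosMap k)) (-(k : ℝ) • toL2 (sinMap k)) := by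
  rw [hasWeakDeriv_iff]
  intro φ φ' h1 h2 h3 h4
  rw [real_inner_smul_right, inner_toL2_toL2, inner_toL2_toL2]
  have hd : ∀ x, HasDerivAt φ (φ' x) x := fun x => by
    rw [← h4]; exact (h1.differentiable (by simp) x).hasDerivAt
  have hφ0 : φ 0 = 0 := image_eq_zero_of_notMem_tsupport fun h => (h3 h).1.false
  have hφπ : φ π = 0 := image_eq_zero_of_notMem_tsupport fun h => (h3 h).2.false
  have := intervalIntegral.integral_mul_deriv_eq_deriv_mul (a := 0) (b := π)
    (fun x _ => hasDerivAt_cosMap k x) (fun x _ => hd x)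
    (Continuous.intervalIntegrable (by fun_prop) _ _)
    (Continuous.intervalIntegrable (by fun_prop) _ _)
  rw [hφ0, hφπ] at this
  simp only [mul_zero, sub_zero, zero_sub, neg_mul, mul_assoc, intervalIntegral.integral_neg,
    intervalIntegral.integral_const_mul] at this
  simp only [cosMap_apply, sinMap_apply, mul_comm (φ' _), mul_comm (φ _)]
  rw [this]
  ring

theorem tendsto_inner_toL2 {F : ℕ → C(ℝ, ℝ)} {G : C(ℝ, ℝ)} {C : ℝ}
    (hF : ∀ n, ∀ x ∈ Set.Ioo (0 : ℝ) π, |F n x| ≤ C)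
    (hG : ∀ x ∈ Set.Ioo (0 : ℝ) π, Tendsto (fun n => F n x) atTop (𝓝 (G x))) (u : L2) :
    Tendsto (fun n => ⟪toL2 (F n), u⟫) atTop (𝓝 ⟪toL2 G, u⟫) := by
  simp only [inner_toL2_left]
  refine tendsto_integral_of_dominated_convergence (fun x => C * ‖u x‖)
    (fun n => (F n).continuous.aestronglyMeasurable.mul (Lp.aestronglyMeasurable u))
    (((Lp.memLp u).integrable (by norm_num)).norm.const_mul C) (fun n => ?_) ?_
  · filter_upwards [ae_restrict_mem measurableSet_Ioo] with x hx
    rw [norm_mul]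
    exact mul_le_mul_of_nonneg_right (hF n x hx) (norm_nonneg _)
  · filter_upwards [ae_restrict_mem measurableSet_Ioo] with x hx
    exact (hG x hx).mul_const _

theorem deriv_smoothTransition_eq_zero {y : ℝ} (hy : y < 0 ∨ 1 < y) :
    deriv smoothTransition y = 0 := by
  rcases hy with hy | hy
  · have : smoothTransition =ᶠ[𝓝 y] fun _ => 0 := by
      filter_upwards [gt_mem_nhds hy] with z hz using smoothTransition.zero_of_nonpos hz.le
    rw [this.deriv_eq, deriv_const]
  · have : smoothTransition =ᶠ[𝓝 y] fun _ => 1 := by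
      filter_upwards [lt_mem_nhds hy] with z hz using smoothTransition.one_of_one_le hz.le
    rw [this.deriv_eq, deriv_const]

theorem continuous_deriv_smoothTransition : Continuous (deriv smoothTransition) :=
  (smoothTransition.contDiff (n := 1)).continuous_deriv (by simp)

/-- The bounds `k x` and `k (π - x)` for `|sin (k x)|`, weighted by `π - x` and `x`. Vanishing at
both ends absorbs the factor `n` from differentiating the cutoff. -/
theorem pi_mul_abs_sin_le (k : ℕ) {x : ℝ} (hx : x ∈ Set.Ioo (0 : ℝ) π) :
    π * |sin (k * x)| ≤ 2 * k * (x * (π - x)) := by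
  have hk : (0 : ℝ) ≤ k := k.cast_nonneg
  have h0 : 0 ≤ π - x := by linarith [hx.2]
  have h1 : |sin (k * x)| ≤ k * x := by
    simpa [abs_mul, abs_of_pos hx.1] using abs_sin_le_abs (x := k * x)
  have h2 : |sin (k * x)| ≤ k * (π - x) := by
    have e : sin (k * x) = -((-1) ^ k * sin (k * (π - x))) := by
      rw [← Real.sin_nat_mul_pi_sub]
      congr 1
      ring
    have : |sin (k * x)| = |sin (k * (π - x))| := by
      rw [e, abs_neg, abs_mul, abs_pow, abs_neg, abs_one, one_pow, one_mul]
    rw [this]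
    simpa [abs_mul, abs_of_nonneg h0] using abs_sin_le_abs (x := k * (π - x))
  have h3 := mul_le_mul_of_nonneg_right h1 h0
  have h4 := mul_le_mul_of_nonneg_right h2 hx.1.le
  linarith

/-- The smooth cutoff of `sin (k x)` vanishing near `0` and `π`. -/
noncomputable def cutSin (k n : ℕ) : C(ℝ, ℝ) :=
  ⟨fun x => sin (k * x) * smoothTransition (n * (x * (π - x)) - 1),
    by have := smoothTransition.continuous; fun_prop⟩

/-- The derivative of `cutSin k n`. -/
noncomputable def cutSin' (k n : ℕ) : C(ℝ, ℝ) :=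
  ⟨fun x => k * cos (k * x) * smoothTransition (n * (x * (π - x)) - 1) +
      sin (k * x) * (deriv smoothTransition (n * (x * (π - x)) - 1) * (n * (π - 2 * x))),
    by
      have := smoothTransition.continuous
      have := continuous_deriv_smoothTransition
      fun_prop⟩

theorem cutSin_apply (k n : ℕ) (x : ℝ) :
    cutSin k n x = sin (k * x) * smoothTransition (n * (x * (π - x)) - 1) := rfl

theorem cutSin'_apply (k n : ℕ) (x : ℝ) :
    cutSin' k n x = k * cos (k * x) * smoothTransition (n * (x * (π - x)) - 1) +
      sin (k * x) * (deriv smoothTransition (n * (x * (π - x)) - 1) * (n * (π - 2 * x))) := rfl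

theorem deriv_cutSin (k n : ℕ) (x : ℝ) : deriv (cutSin k n) x = cutSin' k n x := by
  have h1 : HasDerivAt (fun y : ℝ => (n : ℝ) * (y * (π - y)) - 1) (n * (π - 2 * x)) x := by
    have := ((((hasDerivAt_id x).mul ((hasDerivAt_id x).const_sub π)).const_mul
      (n : ℝ)).sub_const 1)
    refine this.congr_deriv ?_
    simp only [id]
    ring
  have h2 := ((smoothTransition.contDiff (n := 1)).differentiable (by simp)
    ((n : ℝ) * (x * (π - x)) - 1)).hasDerivAt.comp x h1
  exact ((hasDerivAt_sinMap k x).mul h2).deriv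

theorem contDiff_cutSin (k n : ℕ) : ContDiff ℝ ∞ (cutSin k n) := by
  have h1 : ContDiff ℝ ∞ fun x : ℝ => sin (k * x) := by fun_prop
  have h2 : ContDiff ℝ ∞ fun x : ℝ => (n : ℝ) * (x * (π - x)) - 1 := by fun_prop
  exact h1.mul ((smoothTransition.contDiff (n := ⊤)).comp h2)

theorem tsupport_cutSin (k n : ℕ) : tsupport (cutSin k n) ⊆ Set.Ioo 0 π := by
  have h1 : tsupport (cutSin k n) ⊆ {x : ℝ | 1 ≤ (n : ℝ) * (x * (π - x))} := by
    refine closure_minimal (fun x hx => ?_) (isClosed_le (by fun_prop) (by fun_prop))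
    by_contra h
    refine hx ?_
    rw [Set.mem_ofPred_eq, not_le] at h
    rw [cutSin_apply, smoothTransition.zero_of_nonpos (by linarith), mul_zero]
  intro x hx
  have h2 : 1 ≤ (n : ℝ) * (x * (π - x)) := h1 hx
  have h3 : 0 < x * (π - x) :=
    pos_of_mul_pos_right (zero_lt_one.trans_le h2) n.cast_nonneg
  have := pi_pos
  rcases pos_and_pos_or_neg_and_neg_of_mul_pos h3 with h | h
  · exact ⟨h.1, by linarith [h.2]⟩
  · linarith [h.1, h.2]

theorem hasCompactSupport_cutSin (k n : ℕ) : HasCompactSupport (cutSin k n) :=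
  HasCompactSupport.of_support_subset_isCompact (isCompact_Icc (a := (0 : ℝ)) (b := π))
    ((subset_tsupport _).trans ((tsupport_cutSin k n).trans Set.Ioo_subset_Icc_self))

/-- The cutoff varies only where `1 ≤ n x (π - x) ≤ 2`, and there `n |sin (k x)|` is bounded
independently of `n`. This uniform bound allows dominated convergence. -/
theorem exists_bound_cutSin' (k : ℕ) :
    ∃ C, ∀ n, ∀ x ∈ Set.Ioo (0 : ℝ) π, |cutSin' k n x| ≤ C := by
  obtain ⟨C, hC⟩ := (isCompact_Icc (a := (0 : ℝ)) (b := 1)).exists_bound_of_continuousOn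
    continuous_deriv_smoothTransition.continuousOn
  have hC0 : 0 ≤ C := (norm_nonneg _).trans (hC 0 (by simp))
  refine ⟨k + 4 * k * C, fun n x hx => ?_⟩
  have hpi := pi_pos
  have hk : (0 : ℝ) ≤ k := k.cast_nonneg
  have hn : (0 : ℝ) ≤ n := n.cast_nonneg
  rw [cutSin'_apply]
  refine (abs_add_le _ _).trans (add_le_add ?_ ?_)
  · rw [abs_mul, abs_mul, abs_of_nonneg hk, abs_of_nonneg (smoothTransition.nonneg _)]
    calc (k : ℝ) * |cos (k * x)| * smoothTransition (n * (x * (π - x)) - 1) ≤ k * 1 * 1 := by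
          gcongr
          · exact smoothTransition.nonneg _
          · exact abs_cos_le_one _
          · exact smoothTransition.le_one _
      _ = k := by ring
  · by_cases h : (n : ℝ) * (x * (π - x)) - 1 ∈ Set.Icc (0 : ℝ) 1
    · have h1 := pi_mul_abs_sin_le k hx
      have h2 := hC _ h
      rw [Real.norm_eq_abs] at h2
      have h3 : |π - 2 * x| ≤ π := abs_le.2 ⟨by linarith [hx.2], by linarith [hx.1]⟩
      rw [abs_mul, abs_mul, abs_mul, abs_of_nonneg hn]
      calc |sin (k * x)| * (|deriv smoothTransition (n * (x * (π - x)) - 1)| * (n * |π - 2 * x|))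
          ≤ |sin (k * x)| * (C * (n * π)) := by gcongr
        _ = (π * |sin (k * x)|) * (C * n) := by ring
        _ ≤ (2 * k * (x * (π - x))) * (C * n) := by gcongr
        _ = (2 * k * C) * (n * (x * (π - x))) := by ring
        _ ≤ (2 * k * C) * 2 := by
          gcongr
          linarith [h.2]
        _ = 4 * k * C := by ring
    · rw [deriv_smoothTransition_eq_zero (by
        by_contra! h'
        exact h ⟨h'.1, h'.2⟩)]
      simp only [zero_mul, mul_zero, abs_zero]
      positivity

/-- Testing a weak derivative against `sin (k x)`, which vanishes at both ends. -/
theorem HasWeakDeriv.inner_sinMap {u v : L2} (h : HasWeakDeriv u v) (k : ℕ) :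
    ⟪toL2 (sinMap k), v⟫ = -(k * ⟪toL2 (cosMap k), u⟫) := by
  have hev : ∀ x ∈ Set.Ioo (0 : ℝ) π, ∀ᶠ n : ℕ in atTop, 1 < (n : ℝ) * (x * (π - x)) - 1 := by
    intro x hx
    have hw : 0 < x * (π - x) := mul_pos hx.1 (by linarith [hx.2])
    have : Tendsto (fun n : ℕ => (n : ℝ) * (x * (π - x))) atTop atTop :=
      tendsto_natCast_atTop_atTop.atTop_mul_const hw
    filter_upwards [this.eventually_gt_atTop 2] with n hn
    linarith
  obtain ⟨C, hC⟩ := exists_bound_cutSin' k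
  have h1 : Tendsto (fun n => ⟪toL2 (cutSin k n), v⟫) atTop (𝓝 ⟪toL2 (sinMap k), v⟫) := by
    refine tendsto_inner_toL2 (C := 1) (fun n x _ => ?_) (fun x hx => ?_) v
    · rw [cutSin_apply, abs_mul, abs_of_nonneg (smoothTransition.nonneg _)]
      exact mul_le_one₀ (abs_sin_le_one _) (smoothTransition.nonneg _) (smoothTransition.le_one _)
    · refine tendsto_const_nhds.congr' ?_
      filter_upwards [hev x hx] with n hn
      rw [cutSin_apply, smoothTransition.one_of_one_le hn.le, mul_one, sinMap_apply]
  have h2 : Tendsto (fun n => ⟪toL2 (cutSin' k n), u⟫) atTop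
      (𝓝 ⟪toL2 ((k : ℝ) • cosMap k), u⟫) := by
    refine tendsto_inner_toL2 hC (fun x hx => ?_) u
    refine tendsto_const_nhds.congr' ?_
    filter_upwards [hev x hx] with n hn
    rw [cutSin'_apply, smoothTransition.one_of_one_le hn.le,
      deriv_smoothTransition_eq_zero (Or.inr hn)]
    simp
  have h3 : ∀ n, ⟪toL2 (cutSin' k n), u⟫ = -⟪toL2 (cutSin k n), v⟫ := fun n =>
    hasWeakDeriv_iff.1 h _ _ (contDiff_cutSin k n) (hasCompactSupport_cutSin k n)
      (tsupport_cutSin k n) (deriv_cutSin k n)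
  simp only [h3] at h2
  have h4 := tendsto_nhds_unique h2 h1.neg
  rw [map_smul, real_inner_smul_left] at h4
  linarith

/-- The weak eigenvalue equation in cosine coordinates. -/
theorem isNeumannEigenfunction_iff {q : ℝ → ℝ} {Q : L2 →L[ℝ] L2}
    (hQ : ∀ u : L2, Q u =ᵐ[volume.restrict (Set.Ioo (0 : ℝ) π)] fun x => q x * u x)
    (ν : ℝ) (u : L2) : IsNeumannEigenfunction q ν u ↔
      u ≠ 0 ∧ ∀ k : ℕ, (k : ℝ) ^ 2 * ⟪cosBasis k, u⟫ + ⟪cosBasis k, Q u⟫ = ν * ⟪cosBasis k, u⟫ := by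
  have hqint : ∀ φ : L2, ∫ x in Set.Ioo (0 : ℝ) π, q x * (u x * φ x) = ⟪φ, Q u⟫ := by
    intro φ
    rw [inner_L2]
    refine integral_congr_ae ?_
    filter_upwards [hQ u] with x hx
    rw [hx]
    ring
  unfold IsNeumannEigenfunction
  simp only [hqint, ← inner_L2]
  refine and_congr_right fun _ => ⟨?_, fun h => ?_⟩
  · rintro ⟨u', hu', h⟩ k
    have hk := h (toL2 (cosMap k)) _ (hasWeakDeriv_cosMap k)
    rw [real_inner_smul_right, real_inner_comm, hu'.inner_sinMap, real_inner_comm _ u] at hk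
    rw [cosBasis_apply, real_inner_smul_left, real_inner_smul_left]
    linear_combination cosNorm k * hk
  -- `y` plays the role of `-u''`. Its coefficients `k²⟪e k, u⟫` are square summable, so `k⟪e k, u⟫`
  -- is absolutely summable by `2ab ≤ a² + b²`, and the differentiated cosine series converges.
  · set y := ν • u - Q u with hy
    have hyk : ∀ k : ℕ, (k : ℝ) ^ 2 * ⟪cosBasis k, u⟫ = ⟪cosBasis k, y⟫ := by
      intro k
      rw [hy, inner_sub_right, real_inner_smul_right]
      linarith [h k]
    have hsy : Summable fun k : ℕ => ⟪cosBasis k, y⟫ ^ 2 := by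
      have := cosBasis.summable_inner_mul_inner y y
      refine this.congr fun k => ?_
      rw [real_inner_comm]
      ring
    have hu : HasSum (fun k => (⟪cosBasis k, u⟫ * cosNorm k) • toL2 (cosMap k)) u := by
      have := cosBasis.hasSum_repr u
      simpa only [HilbertBasis.repr_apply_apply, cosBasis_apply, smul_smul] using this
    have hsum : Summable fun k : ℕ =>
        (⟪cosBasis k, u⟫ * cosNorm k) • (-(k : ℝ) • toL2 (sinMap k)) := by
      have hs2 : Summable fun k : ℕ => ((k : ℝ) ^ 2)⁻¹ :=
        Real.summable_nat_pow_inv.2 one_lt_two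
      refine Summable.of_norm_bounded (g := fun k : ℕ => (√(2 / π) * √π / 2) *
        (⟪cosBasis k, y⟫ ^ 2 + ((k : ℝ) ^ 2)⁻¹)) ((hsy.add hs2).mul_left _) fun k => ?_
      rcases Nat.eq_zero_or_pos k with rfl | hk
      · simp only [CharP.cast_eq_zero, neg_zero, zero_smul, smul_zero, norm_zero]
        positivity
      have hk' : (0 : ℝ) < k := Nat.cast_pos.2 hk
      have hN : cosNorm k = √(2 / π) := by rw [cosNorm, if_neg hk.ne']
      have hS : ‖toL2 (sinMap k)‖ ≤ √π := by
        simpa using norm_toL2_le (sinMap k) zero_le_one fun x _ => abs_sin_le_one _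
      have e1 : |⟪cosBasis k, u⟫| * k = |⟪cosBasis k, y⟫| * (k : ℝ)⁻¹ := by
        rw [← hyk, abs_mul, abs_of_nonneg (sq_nonneg (k : ℝ))]
        field_simp
      rw [norm_smul, norm_smul, norm_mul, norm_neg, Real.norm_eq_abs, Real.norm_eq_abs,
        Real.norm_eq_abs, abs_of_pos hk', abs_of_pos (cosNorm_pos k), hN]
      calc |⟪cosBasis k, u⟫| * √(2 / π) * (k * ‖toL2 (sinMap k)‖)
          = √(2 / π) * ‖toL2 (sinMap k)‖ * (|⟪cosBasis k, u⟫| * k) := by ring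
        _ ≤ √(2 / π) * √π * (|⟪cosBasis k, u⟫| * k) := by gcongr
        _ ≤ √(2 / π) * √π * ((⟪cosBasis k, y⟫ ^ 2 + ((k : ℝ) ^ 2)⁻¹) / 2) := by
          gcongr
          rw [e1, ← sq_abs ⟪cosBasis k, y⟫, ← inv_pow]
          linarith [two_mul_le_add_sq |⟪cosBasis k, y⟫| (k : ℝ)⁻¹]
        _ = _ := by ring
    refine ⟨_, HasWeakDeriv.hasSum (fun k => (hasWeakDeriv_cosMap k).smul _) hu hsum.hasSum,
      fun φ φ' hφ => ?_⟩
    have e1 := hsum.hasSum.mapL (innerSL ℝ φ')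
    have e2 := cosBasis.hasSum_inner_mul_inner φ y
    simp only [innerSL_apply_apply] at e1
    -- `φ` need not vanish at the ends; no boundary term appears because each `sin (k x)` does.
    -- Parseval then sums the pairings.
    have e3 : ⟪φ', ∑' k : ℕ, (⟪cosBasis k, u⟫ * cosNorm k) • (-(k : ℝ) • toL2 (sinMap k))⟫ =
        ⟪φ, y⟫ := by
      refine e1.unique ?_
      convert e2 using 2 with k
      rw [← hyk, real_inner_comm (cosBasis k) φ, real_inner_smul_right, real_inner_smul_right,
        real_inner_comm (toL2 (sinMap k)) φ', hφ.inner_sinMap]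
      conv_rhs => rw [cosBasis_apply k, real_inner_smul_left]
      rw [cosBasis_apply]
      ring
    rw [real_inner_comm, e3, hy, inner_sub_right, real_inner_smul_right, real_inner_comm u φ]
    ring

end WeakDerivative

/-! ### Matrix entries of `q`, the trace inequality and the limit -/

section Main

variable {q : ℝ → ℝ}

/-- The series converges uniformly on the whole line; its sum replaces `q`, whose values outside
`[0, π]` are arbitrary. -/
theorem exists_continuous_extension (hq : HasAbsConvCosineSeries q) :
    ∃ f : C(ℝ, ℝ), ∀ x ∈ Set.Icc (0 : ℝ) π, q x = f x := by
  have hs : Summable fun k : ℕ => |cosCoeff q (k + 1)| := (summable_nat_add_iff 1).2 hq.1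
  refine ⟨⟨fun x => cosCoeff q 0 / 2 + ∑' k : ℕ, cosCoeff q (k + 1) * cos ((k + 1 : ℕ) * x),
    continuous_const.add (continuous_tsum (fun k => by fun_prop) hs fun k x => ?_)⟩, fun x hx => ?_⟩
  · rw [norm_mul]
    exact mul_le_of_le_one_right (norm_nonneg _) (abs_cos_le_one _)
  · rw [ContinuousMap.coe_mk, (hq.2 x hx).tsum_eq]
    ring

theorem integral_mul_cos_mul_cos {f : C(ℝ, ℝ)} (hf : ∀ x ∈ Set.Icc (0 : ℝ) π, q x = f x)
    (m k : ℕ) (hkm : k ≤ m) :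
    ∫ x in (0 : ℝ)..π, cos (m * x) * (f x * cos (k * x)) =
      π / 4 * (cosCoeff q (m - k) + cosCoeff q (m + k)) := by
  have hpi := pi_pos
  have e : ∀ j : ℕ, cosCoeff q j = 2 / π * ∫ x in (0 : ℝ)..π, f x * cos (j * x) := by
    intro j
    rw [cosCoeff]
    congr 1
    refine intervalIntegral.integral_congr fun x hx => ?_
    rw [Set.uIcc_of_le hpi.le] at hx
    simp only [hf x hx]
  rw [e, e, ← mul_add, ← intervalIntegral.integral_add
    (Continuous.intervalIntegrable (by fun_prop) _ _)
    (Continuous.intervalIntegrable (by fun_prop) _ _), ← mul_assoc,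
    ← intervalIntegral.integral_const_mul]
  refine intervalIntegral.integral_congr fun x _ => ?_
  have h1 : ((m - k : ℕ) : ℝ) * x = m * x - k * x := by rw [Nat.cast_sub hkm]; ring
  have h2 : ((m + k : ℕ) : ℝ) * x = m * x + k * x := by push_cast; ring
  rw [h1, h2, cos_sub, cos_add]
  field_simp
  ring

theorem inner_mulOp {f : C(ℝ, ℝ)} {Q : L2 →L[ℝ] L2}
    (hQ : ∀ u : L2, Q u =ᵐ[volume.restrict (Set.Ioo (0 : ℝ) π)] fun x => f x * u x) (u v : L2) :
    ⟪Q u, v⟫ = ⟪u, Q v⟫ := by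
  rw [inner_L2, inner_L2]
  refine integral_congr_ae ?_
  filter_upwards [hQ u, hQ v] with x h1 h2
  rw [h1, h2]
  ring

theorem inner_cosBasis_mulOp {f : C(ℝ, ℝ)} (hf : ∀ x ∈ Set.Icc (0 : ℝ) π, q x = f x)
    {Q : L2 →L[ℝ] L2}
    (hQ : ∀ u : L2, Q u =ᵐ[volume.restrict (Set.Ioo (0 : ℝ) π)] fun x => f x * u x)
    (m k : ℕ) (hkm : k ≤ m) : ⟪cosBasis m, Q (cosBasis k)⟫ =
      cosNorm m * cosNorm k * (π / 4 * (cosCoeff q (m - k) + cosCoeff q (m + k))) := by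
  rw [cosBasis_apply, cosBasis_apply, map_smul, real_inner_smul_left, real_inner_smul_right,
    ← integral_mul_cos_mul_cos hf m k hkm, inner_toL2_left, ← integral_Ioo_eq, ← mul_assoc]
  congr 1
  refine integral_congr_ae ?_
  filter_upwards [hQ (toL2 (cosMap k)), coeFn_toL2 (cosMap k)] with x h1 h2
  rw [h1, h2, cosMap_apply, cosMap_apply]

theorem inner_cosBasis_mulOp_self {f : C(ℝ, ℝ)} (hf : ∀ x ∈ Set.Icc (0 : ℝ) π, q x = f x)
    {Q : L2 →L[ℝ] L2}
    (hQ : ∀ u : L2, Q u =ᵐ[volume.restrict (Set.Ioo (0 : ℝ) π)] fun x => f x * u x) (k : ℕ) :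
    ⟪cosBasis k, Q (cosBasis k)⟫ =
      cosCoeff q 0 / 2 + if k = 0 then 0 else cosCoeff q (2 * k) / 2 := by
  have hpi := pi_pos
  rw [inner_cosBasis_mulOp hf hQ k k le_rfl, ← sq, cosNorm_sq, Nat.sub_self, ← two_mul]
  split_ifs with h
  · subst h
    field_simp
    ring_nf
  · field_simp
    ring

theorem sum_range_ite_eq (a : ℕ → ℝ) (n : ℕ) :
    ∑ k ∈ Finset.range (n + 1), (if k = 0 then 0 else a k / 2) =
      1 / 2 * ∑ k ∈ Finset.Icc 1 n, a k := by
  induction n with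
  | zero => simp
  | succ n ih =>
    rw [Finset.sum_range_succ, ih, Finset.sum_Icc_succ_top (by omega), if_neg (by omega)]
    ring

theorem not_finiteDimensional_L2 : ¬ FiniteDimensional ℝ L2 := by
  intro h
  have := cosBasis.orthonormal.linearIndependent.finite
  exact not_finite ℕ

theorem summable_inv_sq_add {c : ℝ} (hc : 0 < c) : Summable fun k : ℕ => ((k : ℝ) ^ 2 + c)⁻¹ := by
  rw [← summable_nat_add_iff 1]
  have hs : Summable fun k : ℕ => ((k : ℝ) ^ 2)⁻¹ := Real.summable_nat_pow_inv.2 one_lt_two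
  refine Summable.of_nonneg_of_le (fun k => by positivity) (fun k => ?_)
    ((summable_nat_add_iff 1).2 hs)
  gcongr
  linarith

/-- The Neumann operator as the inverse of a compact operator. -/
theorem exists_neumann_resolvent {f : C(ℝ, ℝ)} (hf : ∀ x ∈ Set.Icc (0 : ℝ) π, q x = f x)
    {Q : L2 →L[ℝ] L2}
    (hQ : ∀ u : L2, Q u =ᵐ[volume.restrict (Set.Ioo (0 : ℝ) π)] fun x => f x * u x) :
    ∃ (c : ℝ) (T : L2 →L[ℝ] L2), IsPosCompact T ∧
      (∀ ν u, IsNeumannEigenfunction q ν u ↔ u ≠ 0 ∧ (ν + c) • T u = u) ∧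
      ∀ k : ℕ, T (((k : ℝ) ^ 2 + c) • cosBasis k + Q (cosBasis k)) = cosBasis k := by
  -- The shift `‖Q‖ + 1` exceeds `‖Q‖`, making the shifted operator positive and invertible.
  have hc : 0 < ‖Q‖ + 1 := by positivity
  obtain ⟨T, hT, hchar⟩ := exists_resolvent cosBasis (summable_inv_sq_add hc)
    (fun k => by positivity) (c := ‖Q‖ + 1) (fun k => by
      rw [← div_eq_mul_inv, div_le_one (by positivity)]
      linarith [sq_nonneg (k : ℝ)]) (inner_mulOp hQ) (lt_add_one _)
  simp only [inv_inv] at hchar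
  have hQq : ∀ u : L2, Q u =ᵐ[volume.restrict (Set.Ioo (0 : ℝ) π)] fun x => q x * u x := by
    intro u
    filter_upwards [hQ u, ae_restrict_mem measurableSet_Ioo] with x h1 h2
    rw [h1, hf x (Set.Ioo_subset_Icc_self h2)]
  refine ⟨‖Q‖ + 1, T, hT, fun ν u => ?_, fun k => ?_⟩
  · rw [isNeumannEigenfunction_iff hQq, ← map_smul, hchar]
    refine and_congr_right fun _ => forall_congr' fun k => ?_
    rw [real_inner_smul_right]
    constructor <;> intro h <;> linarith
  · rw [hchar]
    intro j
    rw [inner_add_right, real_inner_smul_right]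
    by_cases h : j = k
    · rw [h]
    · rw [cosBasis.orthonormal.2 h, mul_zero, mul_zero]

theorem tendsto_half_sum_cosCoeff (hq : HasAbsConvCosineSeries q) :
    Tendsto (fun n : ℕ => (1 / 2 : ℝ) * ∑ k ∈ Finset.Icc 1 n, cosCoeff q (2 * k)) atTop
      (𝓝 (-(1 / 2 : ℝ) * ((1 / π) * ∫ x in (0 : ℝ)..π, q x) + (q 0 + q π) / 4)) := by
  have hpi := pi_pos
  have h0 := hq.2 0 ⟨le_rfl, hpi.le⟩
  have h1 := hq.2 π ⟨hpi.le, le_rfl⟩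
  -- In the sum of the series at `0` and `π`, odd terms cancel and even ones double; hence partial
  -- sums of length `2 n` and the factor `1 / 4`.
  have h2 := ((h0.add h1).tendsto_sum_nat.comp
    (tendsto_id.const_mul_atTop' (two_pos : (0 : ℕ) < 2))).const_mul (1 / 4)
  have h3 : ∀ n : ℕ, ∑ k ∈ Finset.range (2 * n), (cosCoeff q (k + 1) * cos ((k + 1 : ℕ) * 0) +
      cosCoeff q (k + 1) * cos ((k + 1 : ℕ) * π)) =
      2 * ∑ k ∈ Finset.Icc 1 n, cosCoeff q (2 * k) := by
    intro n
    induction n with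
    | zero => simp
    | succ n ih =>
      rw [Finset.sum_Icc_succ_top (by omega), mul_add 2 n 1, mul_one, Finset.sum_range_succ,
        Finset.sum_range_succ, ih, mul_zero, mul_zero, cos_zero, cos_nat_mul_pi, cos_nat_mul_pi,
        show 2 * n + 1 + 1 = 2 * (n + 1) by ring, pow_mul, pow_succ, pow_mul]
      norm_num
      ring
  have h4 : cosCoeff q 0 = 2 / π * ∫ x in (0 : ℝ)..π, q x := by simp [cosCoeff]
  rw [h4] at h2
  convert h2 using 1
  · ext n
    simp only [Function.comp_apply, id_eq, h3]
    ring
  · congr 1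
    ring

theorem trace_inequality (hq : HasAbsConvCosineSeries q) :
    (∀ k : ℕ, IsLeast (neumannLevels q k) (neumannEigenvalue q k)) ∧
    ∀ n : ℕ,
      (∑ k ∈ Finset.range (n + 1), (neumannEigenvalue q k - (k : ℝ) ^ 2 - cosCoeff q 0 / 2)
        ≤ (1 / 2 : ℝ) * ∑ k ∈ Finset.Icc 1 n, cosCoeff q (2 * k)) ∧
      (∑ k ∈ Finset.range (n + 1), (neumannEigenvalue q k - (k : ℝ) ^ 2 - cosCoeff q 0 / 2)
        = (1 / 2 : ℝ) * ∑ k ∈ Finset.Icc 1 n, cosCoeff q (2 * k) →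
      ∃ c : ℝ, ∀ x ∈ Set.Icc 0 π, q x = c) := by
  obtain ⟨f, hf⟩ := exists_continuous_extension hq
  obtain ⟨Q, hQ⟩ := exists_mulOp f
  obtain ⟨c, T, hT, hev, hg⟩ := exists_neumann_resolvent hf hQ
  obtain ⟨u, τ, h⟩ := hT.exists_isEigenSeq not_finiteDimensional_L2
  have hleast : ∀ k, IsLeast (neumannLevels q k) ((τ k)⁻¹ - c) := by
    intro k
    obtain ⟨⟨v, hv, hvt⟩, hlow⟩ := hT.isLeast_levels h k
    refine ⟨⟨v, hv, fun i => ?_⟩, ?_⟩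
    · obtain ⟨ν, hν, h0, h1⟩ := hvt i
      exact ⟨ν - c, by linarith, (hev _ _).2 ⟨h0, by rwa [sub_add_cancel]⟩⟩
    · rintro t ⟨v, hv, hvt⟩
      rw [sub_le_iff_le_add]
      refine hlow ⟨v, hv, fun i => ?_⟩
      obtain ⟨ν, hν, h0⟩ := hvt i
      exact ⟨ν + c, by linarith, (hev _ _).1 h0⟩
  have hμ : ∀ k, neumannEigenvalue q k = (τ k)⁻¹ - c := fun k => (hleast k).csInf_eq
  refine ⟨fun k => by rw [hμ]; exact hleast k, fun n => ?_⟩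
  obtain ⟨g, hgdef⟩ : ∃ g : ℕ → L2, ∀ k : ℕ,
      ((k : ℝ) ^ 2 + c) • cosBasis k + Q (cosBasis k) = g k := ⟨_, fun _ => rfl⟩
  simp only [hgdef] at hg
  have hinner : ∀ i m, ⟪g i, cosBasis m⟫ =
      ((i : ℝ) ^ 2 + c) * ⟪cosBasis i, cosBasis m⟫ + ⟪cosBasis m, Q (cosBasis i)⟫ := by
    intro i m
    rw [← hgdef, inner_add_left, real_inner_smul_left, real_inner_comm (cosBasis m) (Q _)]
  have hself : ∀ i, ⟪g i, cosBasis i⟫ = (i : ℝ) ^ 2 + c + (cosCoeff q 0 / 2 +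
      if i = 0 then 0 else cosCoeff q (2 * i) / 2) := by
    intro i
    rw [hinner, inner_cosBasis_mulOp_self hf hQ, real_inner_self_eq_norm_sq,
      cosBasis.orthonormal.1]
    ring
  have hid : (1 / 2 : ℝ) * ∑ k ∈ Finset.Icc 1 n, cosCoeff q (2 * k) -
      ∑ k ∈ Finset.range (n + 1), (neumannEigenvalue q k - (k : ℝ) ^ 2 - cosCoeff q 0 / 2) =
      ∑ i ∈ Finset.range (n + 1), ⟪g i, cosBasis i⟫ - ∑ k ∈ Finset.range (n + 1), (τ k)⁻¹ := by
    rw [← sum_range_ite_eq (fun k => cosCoeff q (2 * k)), ← Finset.sum_sub_distrib,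
      ← Finset.sum_sub_distrib]
    refine Finset.sum_congr rfl fun k _ => ?_
    rw [hself, hμ]
    ring
  obtain ⟨hle, heq⟩ := hT.kyFan h cosBasis.orthonormal hg n
  refine ⟨by linarith, fun he => ?_⟩
  have hz := heq (by linarith)
  -- Equality makes the span of the first `n + 1` cosines invariant, so the matrix entries of `Q`
  -- leaving it vanish.
  have hz1 : ∀ m i, i ≤ n → n < m → cosCoeff q (m - i) + cosCoeff q (m + i) = 0 := by
    intro m i hi hm
    have h1 := hz (cosBasis m) (fun j hj => cosBasis.orthonormal.2 (by
      have := Finset.mem_range.1 hj; omega)) i (Finset.mem_range.2 (by omega))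
    rw [hinner, cosBasis.orthonormal.2 (by omega), mul_zero, zero_add,
      inner_cosBasis_mulOp hf hQ m i (by omega)] at h1
    have h2 := cosNorm_pos m
    have h3 := cosNorm_pos i
    have h4 := pi_pos
    have h5 : cosNorm m * cosNorm i * (π / 4) ≠ 0 := by positivity
    rw [← mul_assoc] at h1
    exact (mul_eq_zero.1 h1).resolve_left h5
  have hz2 : ∀ m, n < m → cosCoeff q m = 0 := by
    intro m hm
    have := hz1 m 0 (Nat.zero_le _) hm
    simp only [Nat.sub_zero, Nat.add_zero] at this
    linarith
  -- With `i = n` and `m = j + 1 + n`, the index `m - i` is `j + 1`, while `m + i > n` is covered by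
  -- `hz2`.
  have hz3 : ∀ j, cosCoeff q (j + 1) = 0 := by
    intro j
    have h1 := hz1 (j + 1 + n) n le_rfl (by omega)
    rw [Nat.add_sub_cancel, hz2 (j + 1 + n + n) (by omega), add_zero] at h1
    exact h1
  refine ⟨cosCoeff q 0 / 2, fun x hx => ?_⟩
  have h1 := hq.2 x hx
  simp only [hz3, zero_mul] at h1
  exact sub_eq_zero.1 (h1.unique hasSum_zero)

end Main

end NeumannTrace

theorem mainTheorem2 (q : ℝ → ℝ) (hq : NeumannTrace.HasAbsConvCosineSeries q) :
    -- each `μ_k` is well defined: the infimum defining it is attained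
    (∀ k : ℕ, IsLeast (NeumannTrace.neumannLevels q k) (NeumannTrace.neumannEigenvalue q k)) ∧
    (∀ n : ℕ,
      ∑ k ∈ Finset.range (n + 1),
          (NeumannTrace.neumannEigenvalue q k - (k : ℝ) ^ 2 - NeumannTrace.cosCoeff q 0 / 2)
        ≤ (1 / 2 : ℝ) * ∑ k ∈ Finset.Icc 1 n, NeumannTrace.cosCoeff q (2 * k)) ∧
    ((∃ n : ℕ,
      ∑ k ∈ Finset.range (n + 1),
          (NeumannTrace.neumannEigenvalue q k - (k : ℝ) ^ 2 - NeumannTrace.cosCoeff q 0 / 2)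
        = (1 / 2 : ℝ) * ∑ k ∈ Finset.Icc 1 n, NeumannTrace.cosCoeff q (2 * k)) →
      ∃ c : ℝ, ∀ x ∈ Set.Icc 0 π, q x = c) ∧
    Tendsto (fun n : ℕ => (1 / 2 : ℝ) * ∑ k ∈ Finset.Icc 1 n, NeumannTrace.cosCoeff q (2 * k))
      atTop
      (𝓝 (-(1 / 2 : ℝ) * ((1 / π) * ∫ x in (0 : ℝ)..π, q x) + (q 0 + q π) / 4)) := by
  obtain ⟨h1, h2⟩ := NeumannTrace.trace_inequality hq
  exact ⟨h1, fun n => (h2 n).1, fun ⟨n, hn⟩ => (h2 n).2 hn,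
    NeumannTrace.tendsto_half_sum_cosCoeff hq⟩
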